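/- **Setting.** Let $(X,d)$ be a compact metric space and $v:(t,x)\mapsto x\cdot t$ a continuous flow ($t\in\mathbb R$) on $X$. *Cocycles.* A continuous 1-cocycle is a bounded function $\alpha:X\times X\to\mathbb R$ for which there is an open cover $\mathcal U$ of $X$ such that, for each $U\in\mathcal U$, $\alpha$ is continuous on $U\times U$ and $\alpha(x,y)+\alpha(y,z)=\alpha(x,z)$ for $x,y,z\in U$; such a cover is called a cocycle cover for $\alpha$. For a continuous curve $\gamma$ on $[a,b]$, $\int_\gamma\alpha=\sum_k\alpha(\gamma(t_k),\gamma(t_{k+1}))$ for any sufficiently fine partition $(t_k)$ of $[a,b]$; the integral over a trajectory with domain $(a,b)$ is that over its closure on $[a,b]$. We write $[x,x\cdot t]$ for the orbit piece from $x$ to $x\cdot t$. *Chains.* For an open cover $\mathcal U$ and $T>0$, a $(\mathcal U,T)$-chain is a sequence $\tilde\gamma=\{x_0,\dots,x_n\mid t_0,\dots,t_{n-1}\}$, $n\ge1$, with $t_i\ge T$ and such that $x_i\cdot t_i$ and $x_{i+1}$ lie in a common member of $\mathcal U$ for each $i<n$. If $\mathcal U$ is a cocycle cover for $\alpha$, put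 $$\int_{\tilde\gamma}\alpha=\sum_{i<n}\Big(\int_{[x_i,x_i\cdot t_i]}\alpha+\alpha(x_i\cdot t_i,x_{i+1})\Big).$$ *Flow neighborhoods.* An isolating neighborhood of a set $A$ is a compact set $U$ with $A\subset\operatorname{int}U$ whose maximal invariant subset is $A$; $A$ is isolated invariant if it has one. For a closed neighborhood $V$ of $A$ and $r>0$ let $B_r(A)=\{x:d(x,A)\le r\}$ and let $A^{+}(V,r)$ (resp. $A^-(V,r)$) be the set of $x$ for which there is $t\ge0$ (resp. $t\le 0$) such that $x\cdot t\in B_r(A)$ and $x\cdot s\in V$ for all $s$ between $0$ and $t$. A flow neighborhood $A(V,r)$ is a compact set with $B_r(A)\cap V\subset A(V,r)\subset A^+(V,r)\cup A^-(V,r)$ (for instance $A^+(V,r)\cup A^-(V,r)$). *$\alpha$-flows.* Let $\alpha$ be a continuous 1-cocycle. The flow $v$ is an $\alpha$-flow if there are finitely many (possibly no) distinct points $p_1,\dots,p_n$ such that $\{p_1,\dots,p_n\}$ is an isolated invariant set containing all fixed points of $v$, isolating neighborhoods $U_i$ of $\{p_i\}$, closed neighborhoods $V_i\subset U_i$ of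 $p_i$, and constants $r,T_0,\rho>0$, $0\le\lambda<1$, with pairwise disjoint flow neighborhoods $N_i=\{p_i\}(V_i,r)$, such that 1. for each $i$ there are an open set $W_i\supset N_i$ and a continuous $\beta_i:W_i\to\mathbb R$ such that each point of $W_i$ has a neighborhood $O\subset W_i$ with $\alpha(y,z)=\beta_i(z)-\beta_i(y)$ for $y,z\in O$, and $|\beta_i(y)-\beta_i(x)|\le\lambda\rho$ for all $x,y\in N_i$; 2. $\int_\gamma\alpha\ge\rho$ for each trajectory $\gamma$ of the restriction of $v$ to $X\setminus\bigcup_iN_i$ whose maximal interval of existence is a bounded interval $(a,b)$; 3. $\int_{\gamma(T_0)}\alpha\ge\rho$ for each piece $\gamma(T_0)$ of duration $T_0$ of a trajectory of that restriction whose maximal interval of existence is unbounded. *Gradient-like.* $v$ is gradient-like if there is a continuous $g:X\to\mathbb R$ that is strictly decreasing along every nonconstant trajectory of $v$. **Corollary 3.5.** Let $v$ be an $\alpha$-flow on the compact metric space $(X,d)$, let $\mathcal U$ be a cocycle cover for $\alpha$ and let $T>0$. If there is $M>0$ such that $$\Big|\int_{\tilde\gamma}\alpha\Big|\le M$$ for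 every $(\mathcal U,T)$-chain $\tilde\gamma$, then $v$ is gradient-like. -/

import Mathlib

namespace CocycleFlow

open Set Filter Topology

variable {X : Type*}

/-! ### Continuous one-cocycles and their integrals -/

/-- On `U`, the `1`-cochain `α` is continuous and satisfies the (Alexander-Spanier) cocycle
identity `δα = 0`. -/
def IsCocycleOn [TopologicalSpace X] (α : X → X → ℝ) (U : Set X) : Prop :=
  ContinuousOn (fun q : X × X => α q.1 q.2) (U ×ˢ U) ∧
    ∀ x ∈ U, ∀ y ∈ U, ∀ z ∈ U, α x y + α y z = α x z

/-- `𝒰` is an open cover of the space, and `α` is a continuous cocycle on each member. -/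
structure IsCocycleCover [TopologicalSpace X] (α : X → X → ℝ) (𝒰 : Set (Set X)) : Prop where
  isOpen : ∀ U ∈ 𝒰, IsOpen U
  covers : ⋃₀ 𝒰 = univ
  cocycle : ∀ U ∈ 𝒰, IsCocycleOn α U

/-- A continuous `1`-cocycle of bounded Alexander-Spanier cohomology: a bounded function on
`X × X` that is continuous and satisfies `δα = 0` near the diagonal, that is, on the members of
some open cover. -/
structure IsContinuousCocycle [TopologicalSpace X] (α : X → X → ℝ) : Prop where
  bounded : ∃ C : ℝ, ∀ x y, |α x y| ≤ C
  exists_cover : ∃ 𝒰 : Set (Set X), IsCocycleCover α 𝒰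

/-- The integral `∫_γ α` along the curve `γ` on `[a, b]`: the sum of `α` over consecutive points
of a sufficiently fine partition of `[a, b]`. The uniform partitions are used; their sums are
eventually constant, and equal to the sum over every partition whose pieces are mapped into
members of a cover on which `α` is a cocycle (`curveIntegral_eq_sum`). -/
noncomputable def curveIntegral (α : X → X → ℝ) (γ : ℝ → X) (a b : ℝ) : ℝ :=
  limUnder atTop fun n : ℕ => ∑ k ∈ Finset.range n,
    α (γ (a + k * ((b - a) / n))) (γ (a + (k + 1 : ℕ) * ((b - a) / n)))

/-- A primitive of `α` along a curve that has a partition subordinate to a cocycle cover. -/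
theorem exists_primitive [TopologicalSpace X] {α : X → X → ℝ} {𝒰 : Set (Set X)}
    (h𝒰 : IsCocycleCover α 𝒰) (γ : ℝ → X) (t : ℕ → ℝ) (ht : Monotone t) (n : ℕ)
    (hsub : ∀ k < n, ∃ U ∈ 𝒰, ∀ s ∈ Icc (t k) (t (k + 1)), γ s ∈ U) :
    ∃ f : ℝ → ℝ, ∀ U ∈ 𝒰, ∀ s s', t 0 ≤ s → s ≤ s' → s' ≤ t n →
      (∀ u ∈ Icc s s', γ u ∈ U) → α (γ s) (γ s') = f s' - f s := by
  induction n with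
  | zero =>
    refine ⟨fun _ => 0, fun U hU s s' h1 h2 h3 hs => ?_⟩
    have e : s' = s := by linarith
    subst e
    have hx := hs s' ⟨le_rfl, le_rfl⟩
    have := (h𝒰.cocycle U hU).2 _ hx _ hx _ hx
    linarith
  | succ n ih =>
    obtain ⟨f, hf⟩ := ih fun k hk => hsub k (by omega)
    obtain ⟨W, hW, hWs⟩ := hsub n (by omega)
    have h0n : t 0 ≤ t n := ht (Nat.zero_le n)
    have hnn : t n ≤ t (n + 1) := ht (Nat.le_succ n)
    have hcW := (h𝒰.cocycle W hW).2
    have hn := hWs (t n) ⟨le_rfl, hnn⟩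
    have hnn0 : α (γ (t n)) (γ (t n)) = 0 := by
      have := hcW _ hn _ hn _ hn
      linarith
    refine ⟨fun s => if s ≤ t n then f s else f (t n) + α (γ (t n)) (γ s),
      fun U hU s s' h1 h2 h3 hs => ?_⟩
    have hcU := (h𝒰.cocycle U hU).2
    by_cases hs' : s' ≤ t n
    · simp only [if_pos hs', if_pos (h2.trans hs')]
      exact hf U hU s s' h1 h2 hs' hs
    · push Not at hs'
      by_cases hsn : s ≤ t n
      · simp only [if_neg (not_le.2 hs'), if_pos hsn]
        have e1 := hf U hU s (t n) h1 hsn le_rfl fun u hu => hs u ⟨hu.1, hu.2.trans hs'.le⟩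
        have e2 := hcU _ (hs s ⟨le_rfl, h2⟩) _ (hs (t n) ⟨hsn, hs'.le⟩) _ (hs s' ⟨h2, le_rfl⟩)
        linarith
      · simp only [if_neg (not_le.2 hs'), if_neg hsn]
        push Not at hsn
        have e2 := hcW _ hn _ (hWs s ⟨hsn.le, h2.trans h3⟩) _ (hWs s' ⟨hs'.le, h3⟩)
        linarith

/-- The integral of a cocycle along a continuous curve may be computed from any subordinate
partition, and the sums over the uniform partitions are eventually constant. -/
theorem curveIntegral_eq_sum [TopologicalSpace X] {α : X → X → ℝ} {𝒰 : Set (Set X)}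
    (h𝒰 : IsCocycleCover α 𝒰) {γ : ℝ → X} (hγ : Continuous γ) (t : ℕ → ℝ) (ht : Monotone t)
    (n : ℕ) (hsub : ∀ k < n, ∃ U ∈ 𝒰, ∀ s ∈ Icc (t k) (t (k + 1)), γ s ∈ U) :
    (∀ᶠ m : ℕ in atTop, ∑ k ∈ Finset.range m, α (γ (t 0 + k * ((t n - t 0) / m)))
        (γ (t 0 + (k + 1 : ℕ) * ((t n - t 0) / m))) =
      ∑ k ∈ Finset.range n, α (γ (t k)) (γ (t (k + 1)))) ∧
    curveIntegral α γ (t 0) (t n) = ∑ k ∈ Finset.range n, α (γ (t k)) (γ (t (k + 1))) := by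
  obtain ⟨f, hf⟩ := exists_primitive h𝒰 γ t ht n hsub
  have h0n : t 0 ≤ t n := ht (Nat.zero_le n)
  have hsum : ∑ k ∈ Finset.range n, α (γ (t k)) (γ (t (k + 1))) = f (t n) - f (t 0) := by
    rw [← Finset.sum_range_sub (fun k => f (t k))]
    refine Finset.sum_congr rfl fun k hk => ?_
    have hk := Finset.mem_range.1 hk
    obtain ⟨U, hU, hs⟩ := hsub k hk
    exact hf U hU _ _ (ht (Nat.zero_le k)) (ht (Nat.le_succ k)) (ht hk) hs
  have hev : ∀ᶠ m : ℕ in atTop, ∑ k ∈ Finset.range m, α (γ (t 0 + k * ((t n - t 0) / m)))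
      (γ (t 0 + (k + 1 : ℕ) * ((t n - t 0) / m))) = f (t n) - f (t 0) := by
    obtain ⟨δ, hδ, hball⟩ := lebesgue_number_lemma_of_metric_sUnion
      (s := Icc (t 0) (t n)) (c := (fun U => γ ⁻¹' U) '' 𝒰) isCompact_Icc
      (by
        rintro _ ⟨U, hU, rfl⟩
        exact (h𝒰.isOpen U hU).preimage hγ)
      (by
        intro s _
        have : γ s ∈ ⋃₀ 𝒰 := by rw [h𝒰.covers]; trivial
        obtain ⟨U, hU, hs⟩ := this
        exact ⟨_, ⟨U, hU, rfl⟩, hs⟩)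
    have hlim : Tendsto (fun m : ℕ => (t n - t 0) / m) atTop (𝓝 0) :=
      tendsto_const_div_atTop_nhds_zero_nat _
    filter_upwards [hlim.eventually (gt_mem_nhds hδ), eventually_gt_atTop 0] with m hm hm0
    have hmR : (0 : ℝ) < m := by exact_mod_cast hm0
    have hstep : 0 ≤ (t n - t 0) / m := div_nonneg (by linarith) hmR.le
    set d := (t n - t 0) / m with hd
    have hmd : (m : ℝ) * d = t n - t 0 := by rw [hd]; field_simp
    have key : ∀ k ∈ Finset.range m, α (γ (t 0 + k * d)) (γ (t 0 + (k + 1 : ℕ) * d)) =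
        f (t 0 + (k + 1 : ℕ) * d) - f (t 0 + k * d) := by
      intro k hk
      have hk := Finset.mem_range.1 hk
      have hk1 : ((k + 1 : ℕ) : ℝ) ≤ m := by exact_mod_cast hk
      have b0 : 0 ≤ (k : ℝ) * d := mul_nonneg (Nat.cast_nonneg k) hstep
      have b1 : ((k + 1 : ℕ) : ℝ) * d ≤ t n - t 0 := by
        rw [← hmd]; exact mul_le_mul_of_nonneg_right hk1 hstep
      have b2 : ((k + 1 : ℕ) : ℝ) * d = k * d + d := by push_cast; ring
      obtain ⟨_, ⟨U, hU, rfl⟩, hsU⟩ := hball (t 0 + k * d) ⟨by linarith, by linarith⟩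
      refine hf U hU _ _ (by linarith) (by linarith) (by linarith) fun u hu => ?_
      refine hsU ?_
      rw [Metric.mem_ball, Real.dist_eq, abs_of_nonneg (by linarith [hu.1])]
      linarith [hu.2]
    rw [Finset.sum_congr rfl key, Finset.sum_range_sub (fun k : ℕ => f (t 0 + k * d))]
    simp [hmd]
  refine ⟨by simpa only [hsum] using hev, ?_⟩
  rw [hsum]
  exact (tendsto_const_nhds.congr' (hev.mono fun _ h => h.symm)).limUnder_eq

/-- `∫ α` along the piece `[x·a, x·b]` of the orbit of `x`. -/
noncomputable def orbitIntegral [TopologicalSpace X] (v : Flow ℝ X) (α : X → X → ℝ)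
    (x : X) (a b : ℝ) : ℝ :=
  curveIntegral α (fun t => v t x) a b

/-! ### Chains -/

/-- A `(𝒰, T)`-chain `{x₀, …, xₙ | t₀, …, tₙ₋₁}` of the flow: every `tᵢ ≥ T`, and `xᵢ·tᵢ` and
`xᵢ₊₁` lie in a common member of `𝒰`. Only the values of `pt` at `0, …, n` and of `time` at
`0, …, n - 1` matter. -/
structure Chain [TopologicalSpace X] (v : Flow ℝ X) (𝒰 : Set (Set X)) (T : ℝ) where
  n : ℕ
  n_pos : 0 < n
  pt : ℕ → X
  time : ℕ → ℝ
  le_time : ∀ i < n, T ≤ time i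
  jump : ∀ i < n, ∃ U ∈ 𝒰, v (time i) (pt i) ∈ U ∧ pt (i + 1) ∈ U

/-- The integral of `α` along a chain: the integrals along the orbit pieces plus the values of `α`
on the jumps. -/
noncomputable def Chain.integral [TopologicalSpace X] {v : Flow ℝ X} {𝒰 : Set (Set X)} {T : ℝ}
    (c : Chain v 𝒰 T) (α : X → X → ℝ) : ℝ :=
  ∑ i ∈ Finset.range c.n,
    (orbitIntegral v α (c.pt i) 0 (c.time i) + α (v (c.time i) (c.pt i)) (c.pt (i + 1)))

/-! ### Isolated invariant sets and flow neighborhoods -/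

/-- The set of fixed points of a flow. -/
def fixedPoints [TopologicalSpace X] (v : Flow ℝ X) : Set X := {x | ∀ t, v t x = x}

/-- `U` is an isolating neighborhood of `A`: a compact neighborhood of `A` in which `A` is the
maximal invariant set. -/
structure IsIsolatingNeighborhood [TopologicalSpace X] (v : Flow ℝ X) (A U : Set X) : Prop where
  isCompact : IsCompact U
  subset_interior : A ⊆ interior U
  eq_maximal : A = {x | ∀ t, v t x ∈ U}

/-- An isolated invariant set (it may be empty). -/
def IsIsolatedInvariant [TopologicalSpace X] (v : Flow ℝ X) (A : Set X) : Prop :=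
  ∃ U, IsIsolatingNeighborhood v A U

/-- The set of connected components of a subset. -/
def componentsOf [TopologicalSpace X] (S : Set X) : Set (Set X) :=
  {C | ∃ x ∈ S, C = connectedComponentIn S x}

/-- `A⁺(V, r)`: the points whose forward orbit reaches the closed `r`-ball around `A` without
leaving `V` before. -/
def forwardNhd [MetricSpace X] (v : Flow ℝ X) (A V : Set X) (r : ℝ) : Set X :=
  {x | ∃ t, 0 ≤ t ∧ (∀ s ∈ Icc 0 t, v s x ∈ V) ∧ v t x ∈ Metric.cthickening r A}

/-- `A⁻(V, r)`: the same for the backward orbit. -/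
def backwardNhd [MetricSpace X] (v : Flow ℝ X) (A V : Set X) (r : ℝ) : Set X :=
  {x | ∃ t, t ≤ 0 ∧ (∀ s ∈ Icc t 0, v s x ∈ V) ∧ v t x ∈ Metric.cthickening r A}

/-- `N` is a flow neighborhood `A(V, r)`: a compact set that consists of points of `A⁺(V, r)` or
`A⁻(V, r)` and contains all points of `V` at distance at most `r` from `A`. This covers
`A⁺ ∪ A⁻` as well as `A⁺ ∩ A⁻`, `A⁺` and `A⁻`. -/
structure IsFlowNeighborhood [MetricSpace X] (v : Flow ℝ X) (A V : Set X) (r : ℝ)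
    (N : Set X) : Prop where
  isCompact : IsCompact N
  ball_subset : Metric.cthickening r A ∩ V ⊆ N
  subset_nhds : N ⊆ forwardNhd v A V r ∪ backwardNhd v A V r

/-! ### Flows carrying a cocycle -/

/-- `t ↦ x·t`, `t ∈ I`, is a trajectory of the flow restricted to the complement of `N`, with its
maximal interval of existence `I`. -/
structure IsTrajectoryOff [TopologicalSpace X] (v : Flow ℝ X) (N : Set X) (x : X)
    (I : Set ℝ) : Prop where
  nonempty : I.Nonempty
  ordConnected : I.OrdConnected
  avoids : ∀ t ∈ I, v t x ∉ N
  maximal : ∀ J : Set ℝ, J.OrdConnected → I ⊆ J → (∀ t ∈ J, v t x ∉ N) → J ⊆ I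

/-- `[α] = 0` on an open set containing `N`, and the resulting function
`I_α(x, y) = β y - β x`, where `α = δβ` locally, satisfies `|I_α| ≤ c` on `N × N`. -/
def HasOscillationLE [TopologicalSpace X] (α : X → X → ℝ) (N : Set X) (c : ℝ) : Prop :=
  ∃ (W : Set X) (β : X → ℝ), IsOpen W ∧ N ⊆ W ∧ ContinuousOn β W ∧
    (∀ x ∈ W, ∃ O ⊆ W, IsOpen O ∧ x ∈ O ∧ ∀ y ∈ O, ∀ z ∈ O, α y z = β z - β y) ∧
    ∀ x ∈ N, ∀ y ∈ N, |β y - β x| ≤ c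

/-- `v` is a generalized `α`-flow with respect to the isolated invariant set `⋃ i, A i`, which has
the finitely many connected components `A i` and contains the fixed points. -/
structure IsGeneralizedAlphaFlow [MetricSpace X] (v : Flow ℝ X) (α : X → X → ℝ) {n : ℕ}
    (A : Fin n → Set X) : Prop where
  cocycle : IsContinuousCocycle α
  finite_fixed : (componentsOf (fixedPoints v)).Finite
  isolated : IsIsolatedInvariant v (⋃ i, A i)
  fixed_subset : fixedPoints v ⊆ ⋃ i, A i
  injective : Function.Injective A
  components : range A = componentsOf (⋃ i, A i)
  /-- `U i` is an isolating neighborhood of `A i`, `V i` a closed neighborhood of `A i` in `U i`,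
  and `N i = A_i(V i, r)`. Trajectories off `⋃ i, N i` whose interval of existence is bounded (hence
  of the form `(a, b)`) have integral `≥ ρ`; on the others, which exist on a half-line or on the
  whole line, every piece of duration `T₀` has integral `≥ ρ`. -/
  carries : ∃ (U V N : Fin n → Set X) (r T₀ ρ lam : ℝ),
    0 < r ∧ 0 < T₀ ∧ 0 < ρ ∧ 0 ≤ lam ∧ lam < 1 ∧
    (∀ i, IsIsolatingNeighborhood v (A i) (U i)) ∧
    (∀ i, IsClosed (V i) ∧ A i ⊆ interior (V i) ∧ V i ⊆ U i) ∧
    (∀ i, IsFlowNeighborhood v (A i) (V i) r (N i)) ∧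
    (∀ i j, i ≠ j → Disjoint (N i) (N j)) ∧
    (∀ i, HasOscillationLE α (N i) (lam * ρ)) ∧
    (∀ x a b, a < b → IsTrajectoryOff v (⋃ i, N i) x (Ioo a b) → ρ ≤ orbitIntegral v α x a b) ∧
    (∀ x I, IsTrajectoryOff v (⋃ i, N i) x I → (¬ BddAbove I ∨ ¬ BddBelow I) →
      ∀ s, Icc s (s + T₀) ⊆ I → ρ ≤ orbitIntegral v α x s (s + T₀))

/-- `v` is an `α`-flow: a generalized `α`-flow for which the isolated invariant set consists only
of (finitely many, possibly no) points. -/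
def IsAlphaFlow [MetricSpace X] (v : Flow ℝ X) (α : X → X → ℝ) : Prop :=
  ∃ (n : ℕ) (p : Fin n → X), IsGeneralizedAlphaFlow v α fun i => {p i}

/-- `v` is gradient-like: it has a continuous Lyapunov function, strictly decreasing along every
nonconstant trajectory. -/
def IsGradientLike [TopologicalSpace X] (v : Flow ℝ X) : Prop :=
  ∃ g : X → ℝ, Continuous g ∧ ∀ x, x ∉ fixedPoints v → StrictAnti fun t => g (v t x)

end CocycleFlow

namespace CocycleFlow

open Set Filter Topology

variable {X : Type*}

/-! ### Convergence of orbits and connecting orbits -/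

/-! Bounded chain integrals bound the increments of a primitive `F` of `α` along every orbit
(`primitive_sub_le_of_chain_bound`). The local primitives on the flow neighborhoods, each normalized
to have minimum `0`, form one potential `B` on their union `N`, with oscillation at most `λρ`
(`exists_potential`). Along an orbit, `F - B` is constant during a stay in `N` and grows by at least
`ρ - λρ` over each excursion between two visits to `N` (`le_sub_of_gaps`). Boundedness leaves room
for finitely many excursions only, so both ends of each orbit remain in `N`
(`exists_primitive_gain`). By connectedness each end remains in a single flow neighborhood, where
the only full orbit is the rest point; hence every orbit converges to rest points in both time
directions.

A nonconstant orbit from `p` to `q` must leave `N`, and it yields a chain from `p` to `q` with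
integral at least `B q - B p + (ρ - λρ)` (`chainReaches_of_connects`). Around a cycle of connecting
orbits the values of `B` cancel and a closed chain with positive integral remains; its repetitions
violate the bound. So connections are acyclic.

The rest is topological dynamics (`isGradientLike_of_acyclic`). For a rest point `q`, the unstable
set of the points reachable from `q` and the stable set of the other rest points are disjoint closed
sets, an attractor-repeller pair. Its Lyapunov function decreases strictly along the nonconstant
orbits that end at `q`; the sum over all `q` is the required function. -/

/-- There is a nonconstant trajectory from `q` to `q'`. -/
def Connects [TopologicalSpace X] (v : Flow ℝ X) (q q' : X) : Prop :=
  ∃ x, x ∉ fixedPoints v ∧ Tendsto (fun t => v t x) atBot (𝓝 q) ∧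
    Tendsto (fun t => v t x) atTop (𝓝 q')

theorem tendsto_reverse_atTop [TopologicalSpace X] {v : Flow ℝ X} {x : X} {l : Filter X} :
    Tendsto (fun t => v.reverse t x) atTop l ↔ Tendsto (fun t => v t x) atBot l := by
  constructor
  · intro h
    simpa [Function.comp_def, Flow.reverse_apply] using h.comp tendsto_neg_atBot_atTop
  · intro h
    simpa [Function.comp_def, Flow.reverse_apply] using h.comp tendsto_neg_atTop_atBot

theorem tendsto_reverse_atBot [TopologicalSpace X] {v : Flow ℝ X} {x : X} {l : Filter X} :
    Tendsto (fun t => v.reverse t x) atBot l ↔ Tendsto (fun t => v t x) atTop l := by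
  constructor
  · intro h
    simpa [Function.comp_def, Flow.reverse_apply] using h.comp tendsto_neg_atTop_atBot
  · intro h
    simpa [Function.comp_def, Flow.reverse_apply] using h.comp tendsto_neg_atBot_atTop

theorem fixedPoints_reverse [TopologicalSpace X] (v : Flow ℝ X) :
    fixedPoints v.reverse = fixedPoints v := by
  ext x
  refine ⟨fun h t => ?_, fun h t => h (-t)⟩
  simpa [Flow.reverse_apply] using h (-t)

theorem connects_reverse [TopologicalSpace X] {v : Flow ℝ X} {q q' : X} :
    Connects v.reverse q q' ↔ Connects v q' q := by
  simp only [Connects, fixedPoints_reverse, tendsto_reverse_atTop, tendsto_reverse_atBot]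
  exact exists_congr fun x => and_congr_right fun _ => and_comm

/-- An orbit that eventually stays in a compact set containing only one full orbit, a point `q`,
converges to `q`. -/
theorem tendsto_of_eventually_mem [TopologicalSpace X] (v : Flow ℝ X) {B : Set X}
    (hB : IsCompact B) (hBc : IsClosed B) {q : X} (hq : ∀ y, (∀ t, v t y ∈ B) → y = q) {x : X}
    (hx : ∀ᶠ t in atTop, v t x ∈ B) :
    Tendsto (fun t => v t x) atTop (𝓝 q) := by
  -- Time translates of a cluster point of the orbit are again cluster points, so the full orbit of
  -- a cluster point lies in `B`.
  refine hB.tendsto_nhds_of_unique_mapClusterPt hx fun y _ hy => hq y fun s => ?_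
  have h1 : MapClusterPt (v s y) atTop (fun t => v s (v t x)) :=
    hy.continuousAt_comp (v.continuous_toFun s).continuousAt
  have h2 : ∀ᶠ t in atTop, v s (v t x) ∈ B := by
    have := (tendsto_atTop_add_const_left atTop s tendsto_id).eventually hx
    filter_upwards [this] with t ht
    rwa [← v.map_add]
  by_contra hn
  obtain ⟨t, ht1, ht2⟩ := ((h1.frequently (hBc.isOpen_compl.mem_nhds hn)).and_eventually h2).exists
  exact ht1 ht2

theorem tendsto_flow_add_atBot [TopologicalSpace X] (v : Flow ℝ X) {x : X} {l : Filter X} (s : ℝ)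
    (h : Tendsto (fun t => v t x) atBot l) : Tendsto (fun t => v t (v s x)) atBot l := by
  have := h.comp (tendsto_atBot_add_const_right atBot s tendsto_id)
  simpa [Function.comp_def, v.map_add] using this

/-- The union of the unstable sets of the points of `S`. -/
def unstableSet [TopologicalSpace X] (v : Flow ℝ X) (S : Set X) : Set X :=
  {x | ∃ q ∈ S, Tendsto (fun t => v t x) atBot (𝓝 q)}

theorem unstableSet_invariant [TopologicalSpace X] (v : Flow ℝ X) (S : Set X) {x : X}
    (hx : x ∈ unstableSet v S) (s : ℝ) : v s x ∈ unstableSet v S :=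
  let ⟨q, hq, h⟩ := hx
  ⟨q, hq, tendsto_flow_add_atBot v s h⟩

theorem closure_unstableSet_invariant [TopologicalSpace X] (v : Flow ℝ X) (S : Set X) {x : X}
    (hx : x ∈ closure (unstableSet v S)) (s : ℝ) : v s x ∈ closure (unstableSet v S) :=
  map_mem_closure (v.continuous_toFun s) hx fun _ h => unstableSet_invariant v S h s

/-- If a fixed point `q ∉ S` is a limit of points whose orbits emanate from `S`, then some
nonconstant orbit in the closure of the unstable set of `S` ends at `q`. -/
theorem exists_connecting_of_mem_closure [TopologicalSpace X] [T2Space X] [CompactSpace X]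
    (v : Flow ℝ X) (S : Set X) (hSfix : S ⊆ fixedPoints v)
    {q : X} (hq : q ∈ fixedPoints v) (hqS : q ∉ S) {B : Set X} (hB : IsClosed B) (hBq : B ∈ 𝓝 q)
    (hBinv : ∀ x, (∀ t, v t x ∈ B) → x = q) (hcl : q ∈ closure (unstableSet v S)) :
    ∃ z ∈ closure (unstableSet v S), z ∉ fixedPoints v ∧
      Tendsto (fun t => v t z) atTop (𝓝 q) := by
  have hqint : q ∈ interior B := mem_interior_iff_mem_nhds.2 hBq
  -- Otherwise every point of the closure on the frontier of `B` leaves `B` in forward time, by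
  -- compactness within a uniform time `T`. But an orbit that comes from `S` and passes close enough
  -- to `q` stays in `B` for longer than `T` after its entry.
  by_contra! hno
  set K := closure (unstableSet v S) ∩ (B \ interior B) with hK
  have hKc : IsCompact K :=
    (isClosed_closure.inter (hB.sdiff isOpen_interior)).isCompact
  have hexit : ∀ z ∈ K, ∃ t, 0 ≤ t ∧ v t z ∉ B := by
    intro z hz
    by_contra! hst
    have hlim := tendsto_of_eventually_mem v hB.isCompact hB hBinv
      (eventually_atTop.2 ⟨0, hst⟩)
    refine hno z hz.1 (fun hfix => ?_) hlim
    have : Tendsto (fun t => v t z) atTop (𝓝 z) := by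
      simp only [hfix _]; exact tendsto_const_nhds
    exact hz.2.2 (tendsto_nhds_unique this hlim ▸ hqint)
  obtain ⟨T, hT0, hT⟩ : ∃ T : ℝ, 0 ≤ T ∧ K ⊆ {z | ∃ t, 0 ≤ t ∧ t ≤ T ∧ v t z ∉ B} := by
    suffices h : ∃ T : ℝ, K ⊆ {z | ∃ t, 0 ≤ t ∧ t ≤ T ∧ v t z ∉ B} by
      obtain ⟨T, hT⟩ := h
      refine ⟨|T|, abs_nonneg T, fun z hz => ?_⟩
      obtain ⟨t, h0, h1, h2⟩ := hT hz
      exact ⟨t, h0, h1.trans (le_abs_self T), h2⟩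
    refine hKc.elim_directed_cover (fun T : ℝ => {z | ∃ t, 0 ≤ t ∧ t ≤ T ∧ v t z ∉ B}) ?_ ?_ ?_
    · intro T
      have : {z | ∃ t, 0 ≤ t ∧ t ≤ T ∧ v t z ∉ B} = ⋃ t ∈ Icc 0 T, v t ⁻¹' Bᶜ := by
        ext z; simp [and_assoc]
      rw [this]
      exact isOpen_biUnion fun t _ => hB.isOpen_compl.preimage (v.continuous_toFun t)
    · intro z hz
      obtain ⟨t, h0, ht⟩ := hexit z hz
      exact mem_iUnion.2 ⟨t, t, h0, le_rfl, ht⟩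
    · refine Monotone.directed_le fun a b hab z => ?_
      rintro ⟨t, h0, h1, h2⟩
      exact ⟨t, h0, h1.trans hab, h2⟩
  -- orbit pieces of duration `T` issuing backwards from points close to `q` stay in `B`
  have hnear : ∀ᶠ a in 𝓝 q, ∀ s ∈ Icc 0 T, v (-s) a ∈ interior B := by
    have hc : Continuous fun w : ℝ × X => v (-w.1) w.2 := by fun_prop
    have hopen : IsOpen ((fun w : ℝ × X => v (-w.1) w.2) ⁻¹' interior B) :=
      isOpen_interior.preimage hc
    have hsub : Icc 0 T ×ˢ {q} ⊆ (fun w : ℝ × X => v (-w.1) w.2) ⁻¹' interior B := by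
      rintro ⟨s, a⟩ ⟨_, rfl⟩
      change v (-s) a ∈ interior B
      rw [hq]; exact hqint
    obtain ⟨u, w, hu, hw, hu', hw', huw⟩ :=
      generalized_tube_lemma isCompact_Icc isCompact_singleton hopen hsub
    filter_upwards [hw.mem_nhds (hw' rfl)] with a ha s hs
    exact huw (mk_mem_prod (hu' hs) ha)
  obtain ⟨a, ha, p, hpS, hp⟩ := mem_closure_iff_nhds.1 hcl _ hnear
  have hpB : p ∉ B := fun h => hqS (hBinv p (fun t => by rwa [hSfix hpS t]) ▸ hpS)
  -- first backward exit time
  set E := {s : ℝ | 0 ≤ s ∧ v (-s) a ∉ interior B} with hE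
  have hEc : IsClosed E := by
    have : Continuous fun s : ℝ => v (-s) a := by fun_prop
    exact isClosed_Ici.inter (isOpen_interior.isClosed_compl.preimage this)
  have hEne : E.Nonempty := by
    have h1 := (hp.comp tendsto_neg_atTop_atBot).eventually (hB.isOpen_compl.mem_nhds hpB)
    obtain ⟨s, hs1, hs0⟩ := (h1.and (eventually_ge_atTop 0)).exists
    exact ⟨s, hs0, fun h => hs1 (interior_subset h)⟩
  have hEb : BddBelow E := ⟨0, fun s hs => hs.1⟩
  set s := sInf E with hs
  have hsE : s ∈ E := hEc.csInf_mem hEne hEb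
  have hTs : T < s := by
    by_contra! h
    exact hsE.2 (ha s ⟨hsE.1, h⟩)
  have hbefore : ∀ u, 0 ≤ u → u < s → v (-u) a ∈ interior B := by
    intro u hu0 hus
    by_contra hu
    exact absurd (csInf_le hEb ⟨hu0, hu⟩) (not_le.2 hus)
  have hs0 : 0 < s := hT0.trans_lt hTs
  have hzB : v (-s) a ∈ B := by
    have hc : Continuous fun u : ℝ => v (-u) a := by fun_prop
    have hcs : s ∈ closure (Ico 0 s) := by
      rw [closure_Ico hs0.ne]; exact ⟨hs0.le, le_rfl⟩
    exact closure_minimal interior_subset hB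
      (map_mem_closure (f := fun u => v (-u) a) hc hcs fun u hu => hbefore u hu.1 hu.2)
  have haA : a ∈ unstableSet v S := ⟨p, hpS, hp⟩
  obtain ⟨t, ht0, htT, ht⟩ :=
    hT ⟨subset_closure (unstableSet_invariant v S haA (-s)), hzB, hsE.2⟩
  rw [← v.map_add] at ht
  rcases ht0.eq_or_lt with rfl | htpos
  · rw [zero_add] at ht
    exact ht hzB
  · refine ht (interior_subset ?_)
    have := hbefore (s - t) (by linarith) (by linarith)
    rwa [neg_sub, sub_eq_add_neg] at this

/-- If the connections between finitely many isolated fixed points have no cycles, the union of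
the unstable sets of a down-set of these points is closed. -/
theorem isClosed_unstableSet [TopologicalSpace X] [T2Space X] [CompactSpace X]
    (v : Flow ℝ X) {P : Set X} (hP : P.Finite) (hfix : P ⊆ fixedPoints v)
    (hiso : ∀ q ∈ P, ∃ B, IsClosed B ∧ B ∈ 𝓝 q ∧ ∀ x, (∀ t, v t x ∈ B) → x = q)
    (hbot : ∀ x, ∃ q ∈ P, Tendsto (fun t => v t x) atBot (𝓝 q))
    (hac : ∀ q, ¬ Relation.TransGen (Connects v) q q)
    {S : Set X} (hSP : S ⊆ P) (hS : ∀ q ∈ S, ∀ q', Connects v q q' → q' ∈ S) :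
    IsClosed (unstableSet v S) := by
  -- The closure is closed and invariant, so it contains the backward limits of its points; only
  -- rest points need to be checked.
  have key : ∀ q ∈ P, q ∈ closure (unstableSet v S) → q ∈ S := by
    by_contra! hne
    obtain ⟨q₀, hq₀⟩ := hne
    let Q := {q | q ∈ P ∧ q ∈ closure (unstableSet v S) ∧ q ∉ S}
    have : Std.Irrefl (Relation.TransGen (Connects v)) := ⟨hac⟩
    have : IsStrictOrder X (Relation.TransGen (Connects v)) := {}
    have hwf : Q.WellFoundedOn (Relation.TransGen (Connects v)) :=
      (hP.subset fun q hq => hq.1).wellFoundedOn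
    -- A counterexample `q` is the end of a connecting orbit whose source is again a counterexample.
    -- Finiteness and acyclicity exclude such a descent.
    refine hwf.induction (P := fun _ => False) (show q₀ ∈ Q from hq₀) fun q hq ih => ?_
    obtain ⟨B, hB, hBq, hBinv⟩ := hiso q hq.1
    obtain ⟨z, hz, hzfix, hzq⟩ := exists_connecting_of_mem_closure v S (hSP.trans hfix)
      (hfix hq.1) hq.2.2 hB hBq hBinv hq.2.1
    obtain ⟨q', hq'P, hq'⟩ := hbot z
    have hcon : Connects v q' q := ⟨z, hzfix, hq', hzq⟩
    refine ih q' ⟨hq'P, ?_, fun h => hq.2.2 (hS q' h q hcon)⟩ (.single hcon)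
    exact isClosed_closure.mem_of_tendsto hq'
      (Eventually.of_forall fun t => closure_unstableSet_invariant v S hz t)
  refine isClosed_of_closure_subset fun x hx => ?_
  obtain ⟨q, hqP, hq⟩ := hbot x
  refine ⟨q, key q hqP ?_, hq⟩
  exact isClosed_closure.mem_of_tendsto hq
    (Eventually.of_forall fun t => closure_unstableSet_invariant v S hx t)

/-! ### Lyapunov functions of attractor-repeller pairs -/

/-- If backward orbits of the points of the compact set `K` enter the interior of `K`, the set of
points whose forward orbit meets `K` is closed. -/
theorem isClosed_hitting [TopologicalSpace X] [T2Space X] [CompactSpace X] (v : Flow ℝ X)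
    {K : Set X} (hK : IsClosed K) (hback : ∀ y ∈ K, ∃ t, 0 < t ∧ v (-t) y ∈ interior K) :
    IsClosed {x | ∃ t, 0 ≤ t ∧ v t x ∈ K} := by
  obtain ⟨T, hT⟩ : ∃ T : ℝ, K ⊆ {y | ∃ t, 0 < t ∧ t ≤ T ∧ v (-t) y ∈ interior K} := by
    refine hK.isCompact.elim_directed_cover
      (fun T : ℝ => {y | ∃ t, 0 < t ∧ t ≤ T ∧ v (-t) y ∈ interior K}) ?_ ?_ ?_
    · intro T
      have : {y | ∃ t, 0 < t ∧ t ≤ T ∧ v (-t) y ∈ interior K} =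
          ⋃ t ∈ Ioc 0 T, v (-t) ⁻¹' interior K := by
        ext z; simp [and_assoc]
      rw [this]
      exact isOpen_biUnion fun t _ => isOpen_interior.preimage (v.continuous_toFun (-t))
    · intro z hz
      obtain ⟨t, h0, ht⟩ := hback z hz
      exact mem_iUnion.2 ⟨t, t, h0, le_rfl, ht⟩
    · refine Monotone.directed_le fun a b hab z => ?_
      rintro ⟨t, h0, h1, h2⟩
      exact ⟨t, h0, h1.trans hab, h2⟩
  -- The first hitting time is less than `T`: otherwise going back from the first hit would give an
  -- earlier one. The set is thus a compact image.
  have hEq : {x | ∃ t, 0 ≤ t ∧ v t x ∈ K} =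
      (fun w : ℝ × X => v (-w.1) w.2) '' (Icc 0 T ×ˢ K) := by
    ext x
    constructor
    · rintro ⟨t, ht0, ht⟩
      set E := {s : ℝ | s ∈ Icc 0 t ∧ v s x ∈ K}
      have hEc : IsCompact E :=
        isCompact_Icc.inter_right (hK.preimage (f := fun s => v s x) (by fun_prop))
      obtain ⟨s, hsE, hmin⟩ := hEc.exists_isLeast ⟨t, ⟨ht0, le_rfl⟩, ht⟩
      obtain ⟨u, hu0, huT, hu⟩ := hT hsE.2
      rw [← v.map_add] at hu
      have hsu : s < u := by
        by_contra! h
        have := hmin ⟨⟨by linarith, by linarith [hsE.1.2]⟩, interior_subset hu⟩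
        linarith
      refine ⟨(s, v s x), ⟨⟨hsE.1.1, by linarith⟩, hsE.2⟩, ?_⟩
      simp [← v.map_add]
    · rintro ⟨⟨s, y⟩, ⟨hs, hy⟩, rfl⟩
      exact ⟨s, hs.1, by simpa [← v.map_add] using hy⟩
  rw [hEq]
  exact ((isCompact_Icc.prod hK.isCompact).image (by fun_prop)).isClosed

/-- A continuous function that does not increase along orbits can be averaged into one that
decreases strictly wherever the original function decreases at some later time. -/
theorem exists_strict_average [TopologicalSpace X] (v : Flow ℝ X) {h : X → ℝ} (hc : Continuous h)
    (h0 : ∀ x, 0 ≤ h x) (h1 : ∀ x, h x ≤ 1) (hanti : ∀ x t, 0 ≤ t → h (v t x) ≤ h x) :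
    ∃ g : X → ℝ, Continuous g ∧ (∀ x t, 0 ≤ t → g (v t x) ≤ g x) ∧
      ∀ x s, 0 ≤ s → (∃ t, 0 ≤ t ∧ h (v (t + s) x) < h (v t x)) → g (v s x) < g x := by
  -- Sampling times dense in `[0, ∞)`; a strict decrease of `h` is an open condition on time and is
  -- therefore seen at one of them.
  let τ : ℕ → ℝ := fun n => |TopologicalSpace.denseSeq ℝ n|
  let f : ℕ → X → ℝ := fun n x => (1 / 2) ^ n * h (v (τ n) x)
  have hfb : ∀ n x, ‖f n x‖ ≤ (1 / 2) ^ n := by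
    intro n x
    rw [Real.norm_of_nonneg (mul_nonneg (by positivity) (h0 _))]
    exact mul_le_of_le_one_right (by positivity) (h1 _)
  have hsum : ∀ x, Summable fun n => f n x := fun x =>
    Summable.of_norm_bounded summable_geometric_two (fun n => hfb n x)
  have hle : ∀ x s, 0 ≤ s → ∀ n, f n (v s x) ≤ f n x := by
    intro x s hs n
    refine mul_le_mul_of_nonneg_left ?_ (by positivity)
    rw [← v.map_add, add_comm, v.map_add]
    exact hanti _ _ hs
  refine ⟨fun x => ∑' n, f n x, ?_, ?_, ?_⟩
  · refine continuous_tsum (fun n => ?_) summable_geometric_two hfb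
    exact continuous_const.mul (hc.comp (v.continuous_toFun _))
  · intro x s hs
    exact (hsum _).tsum_le_tsum (hle x s hs) (hsum _)
  · rintro x s hs ⟨t, ht0, ht⟩
    have hopen : IsOpen {u : ℝ | h (v (|u| + s) x) < h (v |u| x)} :=
      isOpen_lt (by fun_prop) (by fun_prop)
    obtain ⟨_, hu, n, rfl⟩ := (TopologicalSpace.denseRange_denseSeq ℝ).inter_open_nonempty _ hopen
      ⟨t, by simpa [abs_of_nonneg ht0] using ht⟩
    refine Summable.tsum_lt_tsum (i := n) (hle x s hs) ?_ (hsum _) (hsum _)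
    refine mul_lt_mul_of_pos_left ?_ (by positivity)
    rw [← v.map_add]
    exact hu

/-- A pair of disjoint closed sets `A`, `R`, such that orbits off `R` tend to `A` in forward
time and orbits off `A` tend to `R` in backward time, has a Lyapunov function. -/
theorem exists_lyapunov_attractor_repeller [MetricSpace X] [CompactSpace X] (v : Flow ℝ X)
    {A R : Set X} (hA : IsClosed A) (hR : IsClosed R) (hdisj : Disjoint A R)
    (hAinv : ∀ x ∈ A, ∀ t, v t x ∈ A)
    (htop : ∀ x ∉ R, ∃ q ∈ A, Tendsto (fun t => v t x) atTop (𝓝 q))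
    (hbot : ∀ x ∉ A, ∃ q ∈ R, Tendsto (fun t => v t x) atBot (𝓝 q)) :
    ∃ g : X → ℝ, Continuous g ∧ (∀ x t, 0 ≤ t → g (v t x) ≤ g x) ∧
      ∀ x, x ∉ A → x ∉ R → ∀ t, 0 < t → g (v t x) < g x := by
  -- A point off `A ∪ R` makes both sets nonempty, as needed below because `infDist` to the empty
  -- set is `0`.
  by_cases hne : ∃ x, x ∉ A ∧ x ∉ R
  swap
  · push Not at hne
    exact ⟨fun _ => 0, continuous_const, fun _ _ _ => le_rfl, fun x h1 h2 => absurd (hne x h1) h2⟩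
  obtain ⟨x₀, hx₀A, hx₀R⟩ := hne
  have hAne : A.Nonempty := let ⟨q, hq, _⟩ := htop x₀ hx₀R; ⟨q, hq⟩
  have hRne : R.Nonempty := let ⟨q, hq, _⟩ := hbot x₀ hx₀A; ⟨q, hq⟩
  have hpos : ∀ x, 0 < Metric.infDist x A + Metric.infDist x R := by
    intro x
    by_cases hx : x ∈ A
    · exact add_pos_of_nonneg_of_pos Metric.infDist_nonneg
        ((hR.notMem_iff_infDist_pos hRne).1 (disjoint_left.1 hdisj hx))
    · exact add_pos_of_pos_of_nonneg ((hA.notMem_iff_infDist_pos hAne).1 hx)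
        Metric.infDist_nonneg
  let l : X → ℝ := fun x => Metric.infDist x A / (Metric.infDist x A + Metric.infDist x R)
  have hlc : Continuous l := (Metric.continuous_infDist_pt A).div
    ((Metric.continuous_infDist_pt A).add (Metric.continuous_infDist_pt R)) fun x => (hpos x).ne'
  have hl0 : ∀ x, 0 ≤ l x := fun x => div_nonneg Metric.infDist_nonneg (hpos x).le
  have hl1 : ∀ x, l x ≤ 1 := fun x =>
    (div_le_one (hpos x)).2 (le_add_of_nonneg_right Metric.infDist_nonneg)
  have hlA : ∀ x ∈ A, l x = 0 := fun x hx => by simp [l, Metric.infDist_zero_of_mem hx]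
  have hlApos : ∀ x ∉ A, 0 < l x := fun x hx =>
    div_pos ((hA.notMem_iff_infDist_pos hAne).1 hx) (hpos x)
  have hlR : ∀ x ∈ R, l x = 1 := fun x hx => by
    have := hpos x
    simp only [l]
    rw [Metric.infDist_zero_of_mem hx, add_zero] at this ⊢
    exact div_self this.ne'
  -- The supremum over the forward orbit makes `l` nonincreasing along orbits. Lower semicontinuity
  -- is automatic; upper semicontinuity comes from `hclosed`.
  let h : X → ℝ := fun x => ⨆ t : Ici (0 : ℝ), l (v t x)
  have hbdd : ∀ x, BddAbove (range fun t : Ici (0 : ℝ) => l (v t x)) := fun x =>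
    ⟨1, by rintro _ ⟨t, rfl⟩; exact hl1 _⟩
  have hle : ∀ x t, 0 ≤ t → l (v t x) ≤ h x := fun x t ht => le_ciSup (hbdd x) ⟨t, ht⟩
  have hsup : ∀ x c, (∀ t, 0 ≤ t → l (v t x) ≤ c) → h x ≤ c := fun x c hc =>
    ciSup_le fun t => hc t t.2
  have hself : ∀ x, l x ≤ h x := fun x => by simpa using hle x 0 le_rfl
  have h0 : ∀ x, 0 ≤ h x := fun x => (hl0 x).trans (hself x)
  have h1 : ∀ x, h x ≤ 1 := fun x => hsup x 1 fun t _ => hl1 _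
  have hanti : ∀ x t, 0 ≤ t → h (v t x) ≤ h x := fun x t ht => hsup _ _ fun s hs => by
    rw [← v.map_add]; exact hle x _ (add_nonneg hs ht)
  -- A point with `l ≥ c > 0` is off `A`, so its backward orbit tends to `R`, where `l = 1 > c`.
  have hclosed : ∀ c, 0 < c → c < 1 → IsClosed {x | ∃ t, 0 ≤ t ∧ v t x ∈ {y | c ≤ l y}} := by
    intro c hc0 hc1
    refine isClosed_hitting v (isClosed_le continuous_const hlc) fun y hy => ?_
    have hyA : y ∉ A := fun h => by
      have : c ≤ l y := hy
      linarith [hlA y h]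
    obtain ⟨q, hqR, hq⟩ := hbot y hyA
    have hint : {y | c ≤ l y} ∈ 𝓝 q :=
      mem_of_superset ((isOpen_lt continuous_const hlc).mem_nhds (by simpa [hlR q hqR] using hc1))
        fun z (hz : c < l z) => hz.le
    have := (hq.comp tendsto_neg_atTop_atBot).eventually (interior_mem_nhds.2 hint)
    obtain ⟨t, ht, ht0⟩ := (this.and (eventually_gt_atTop 0)).exists
    exact ⟨t, ht0, ht⟩
  have hcont : Continuous h := by
    refine OrderTopology.continuous_iff.2 fun a => ⟨?_, ?_⟩
    · have : h ⁻¹' Ioi a = ⋃ t : Ici (0 : ℝ), {x | a < l (v t x)} := by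
        ext x
        simp only [mem_preimage, mem_Ioi, mem_iUnion, mem_ofPred_eq]
        exact lt_ciSup_iff (hbdd x)
      rw [this]
      exact isOpen_iUnion fun t => isOpen_lt continuous_const (hlc.comp (v.continuous_toFun _))
    · rcases lt_or_ge 1 a with ha | ha
      · have : h ⁻¹' Iio a = univ := eq_univ_of_forall fun x => (h1 x).trans_lt ha
        rw [this]; exact isOpen_univ
      have : h ⁻¹' Iio a = ⋃ c ∈ Ioo 0 a, {x | ∃ t, 0 ≤ t ∧ v t x ∈ {y | c ≤ l y}}ᶜ := by
        ext x
        simp only [mem_preimage, mem_Iio, mem_iUnion, mem_compl_iff, mem_ofPred_eq, not_exists,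
          not_and, not_le]
        constructor
        · intro hx
          obtain ⟨c, hc1, hc2⟩ := exists_between hx
          exact ⟨c, ⟨(h0 x).trans_lt hc1, hc2⟩, fun t ht => (hle x t ht).trans_lt hc1⟩
        · rintro ⟨c, hc, hx⟩
          exact (hsup x c fun t ht => (hx t ht).le).trans_lt hc.2
      rw [this]
      exact isOpen_biUnion fun c hc => (hclosed c hc.1 (hc.2.trans_le ha)).isOpen_compl
  obtain ⟨g, hg, hgle, hglt⟩ := exists_strict_average v hcont h0 h1 hanti
  refine ⟨g, hg, hgle, fun x hxA hxR s hs => hglt x s hs.le ?_⟩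
  -- Without a later decrease, `h` stays at least `h x > 0` at all multiples of `s`, although these
  -- points converge to a point of `A`, where `h = 0`.
  by_contra! hcon
  have hconst : ∀ n : ℕ, h x ≤ h (v (n * s) x) := by
    intro n
    induction n with
    | zero => simp
    | succ n ih =>
      have := hcon (n * s) (by positivity)
      push_cast
      rw [add_mul, one_mul]
      exact ih.trans this
  obtain ⟨q, hqA, hq⟩ := htop x hxR
  have hhA : h q = 0 := le_antisymm (hsup q 0 fun t _ => (hlA _ (hAinv q hqA t)).le) (h0 q)
  have hlim : Tendsto (fun n : ℕ => h (v (n * s) x)) atTop (𝓝 (h q)) :=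
    (hcont.tendsto q).comp (hq.comp (tendsto_natCast_atTop_atTop.atTop_mul_const hs))
  have := ge_of_tendsto' hlim hconst
  linarith [hself x, hlApos x hxA]

/-- A flow with finitely many isolated fixed points, whose orbits all converge to fixed points in
both time directions without cycles of connecting orbits, is gradient-like. -/
theorem isGradientLike_of_acyclic [MetricSpace X] [CompactSpace X] (v : Flow ℝ X)
    {P : Set X} (hP : P.Finite) (hfix : P ⊆ fixedPoints v)
    (hiso : ∀ q ∈ P, ∃ B, IsClosed B ∧ B ∈ 𝓝 q ∧ ∀ x, (∀ t, v t x ∈ B) → x = q)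
    (htop : ∀ x, ∃ q ∈ P, Tendsto (fun t => v t x) atTop (𝓝 q))
    (hbot : ∀ x, ∃ q ∈ P, Tendsto (fun t => v t x) atBot (𝓝 q))
    (hac : ∀ q, ¬ Relation.TransGen (Connects v) q q) : IsGradientLike v := by
  have hmem : ∀ {q q'}, Connects v q q' → q ∈ P ∧ q' ∈ P := by
    rintro q q' ⟨x, _, h1, h2⟩
    obtain ⟨a, ha, hxa⟩ := hbot x
    obtain ⟨b, hb, hxb⟩ := htop x
    exact ⟨tendsto_nhds_unique h1 hxa ▸ ha, tendsto_nhds_unique h2 hxb ▸ hb⟩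
  have hiso' : ∀ q ∈ P, ∃ B, IsClosed B ∧ B ∈ 𝓝 q ∧ ∀ x, (∀ t, v.reverse t x ∈ B) → x = q := by
    intro q hq
    obtain ⟨B, h1, h2, h3⟩ := hiso q hq
    refine ⟨B, h1, h2, fun x hx => h3 x fun t => ?_⟩
    simpa [Flow.reverse_apply] using hx (-t)
  have hac' : ∀ q, ¬ Relation.TransGen (Connects v.reverse) q q := by
    intro q hq
    refine hac q (Relation.transGen_swap.1
      (Relation.TransGen.mono (fun _ _ h => connects_reverse.1 h) _ _ hq))
  have hpair : ∀ q : X, ∃ g : X → ℝ, Continuous g ∧ (∀ x t, 0 ≤ t → g (v t x) ≤ g x) ∧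
      ∀ x ∉ fixedPoints v, Tendsto (fun t => v t x) atTop (𝓝 q) →
        ∀ t, 0 < t → g (v t x) < g x := by
    intro q
    set S := {q' ∈ P | Relation.ReflTransGen (Connects v) q q'} with hSdef
    have hSP : S ⊆ P := fun _ h => h.1
    have hS : ∀ a ∈ S, ∀ b, Connects v a b → b ∈ S := fun a ha b hab =>
      ⟨(hmem hab).2, ha.2.tail hab⟩
    have hA : IsClosed (unstableSet v S) := isClosed_unstableSet v hP hfix hiso hbot hac hSP hS
    have hR : IsClosed (unstableSet v.reverse (P \ S)) := by
      refine isClosed_unstableSet v.reverse hP (fixedPoints_reverse v ▸ hfix) hiso' ?_ hac'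
        sdiff_subset ?_
      · intro x
        simpa only [tendsto_reverse_atBot] using htop x
      · intro a ha b hab
        have hba := connects_reverse.1 hab
        exact ⟨(hmem hba).1, fun hb => ha.2 (hS b hb a hba)⟩
    have hRiff : ∀ x, x ∈ unstableSet v.reverse (P \ S) ↔
        ∃ a ∈ P \ S, Tendsto (fun t => v t x) atTop (𝓝 a) := by
      intro x
      simp only [unstableSet, tendsto_reverse_atBot, mem_ofPred_eq]
    have hfixlim : ∀ {a : X} {f : Filter ℝ}, a ∈ P → Tendsto (fun t => v t a) f (𝓝 a) := by
      intro a f ha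
      simp only [hfix ha _]
      exact tendsto_const_nhds
    have hdisj : Disjoint (unstableSet v S) (unstableSet v.reverse (P \ S)) := by
      refine disjoint_left.2 fun x hxA hxR => ?_
      obtain ⟨a, ha, hxa⟩ := hxA
      obtain ⟨b, hb, hxb⟩ := (hRiff x).1 hxR
      by_cases hx : x ∈ fixedPoints v
      · have e1 : a = b := by
          simp only [hx _] at hxa hxb
          exact (tendsto_nhds_unique hxa tendsto_const_nhds).trans
            (tendsto_nhds_unique hxb tendsto_const_nhds).symm
        exact hb.2 (e1 ▸ ha)
      · exact hb.2 (hS a ha b ⟨x, hx, hxa, hxb⟩)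
    have hAtop : ∀ x ∉ unstableSet v.reverse (P \ S),
        ∃ a ∈ unstableSet v S, Tendsto (fun t => v t x) atTop (𝓝 a) := by
      intro x hx
      obtain ⟨a, ha, hxa⟩ := htop x
      have haS : a ∈ S := by
        by_contra h
        exact hx ((hRiff x).2 ⟨a, ⟨ha, h⟩, hxa⟩)
      exact ⟨a, ⟨a, haS, hfixlim ha⟩, hxa⟩
    have hRbot : ∀ x ∉ unstableSet v S,
        ∃ a ∈ unstableSet v.reverse (P \ S), Tendsto (fun t => v t x) atBot (𝓝 a) := by
      intro x hx
      obtain ⟨a, ha, hxa⟩ := hbot x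
      have haS : a ∉ S := fun h => hx ⟨a, h, hxa⟩
      exact ⟨a, (hRiff a).2 ⟨a, ⟨ha, haS⟩, hfixlim ha⟩, hxa⟩
    obtain ⟨g, hg, hgle, hglt⟩ := exists_lyapunov_attractor_repeller v hA hR hdisj
      (fun x hx t => unstableSet_invariant v S hx t) hAtop hRbot
    -- An orbit ending at `q` and starting in `S` would close a cycle through `q`; it avoids the
    -- repeller because `q ∈ S`.
    refine ⟨g, hg, hgle, fun x hx hxq t ht => hglt x ?_ ?_ t ht⟩
    · rintro ⟨a, ha, hxa⟩
      exact hac q (Relation.TransGen.tail' ha.2 ⟨x, hx, hxa, hxq⟩)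
    · rw [hRiff]
      rintro ⟨a, ha, hxa⟩
      obtain rfl := tendsto_nhds_unique hxa hxq
      exact ha.2 ⟨ha.1, .refl⟩
  choose g hg hgle hglt using hpair
  refine ⟨fun x => ∑ q ∈ hP.toFinset, g q x, continuous_finsetSum _ fun q _ => hg q,
    fun x hx s t hst => ?_⟩
  have hdiff : v t x = v (t - s) (v s x) := by rw [← v.map_add]; simp
  obtain ⟨q, hqP, hq⟩ := htop x
  simp only [hdiff]
  have hsx : v s x ∉ fixedPoints v := fun h => hx fun u => by
    have h1 := h (u - s)
    have h2 := h (-s)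
    rw [← v.map_add] at h1 h2
    simp only [sub_add_cancel, neg_add_cancel, v.map_zero_apply] at h1 h2
    rw [h1, ← h2]
  have hsq : Tendsto (fun t => v t (v s x)) atTop (𝓝 q) := by
    have := hq.comp (tendsto_atTop_add_const_right atTop s tendsto_id)
    simpa [Function.comp_def, v.map_add] using this
  exact Finset.sum_lt_sum (fun q _ => hgle q _ _ (sub_nonneg.2 hst.le))
    ⟨q, hP.mem_toFinset.2 hqP, hglt q _ hsx hsq _ (sub_pos.2 hst)⟩

/-! ### Primitives of a cocycle along an orbit -/

theorem IsCocycleOn.self [TopologicalSpace X] {α : X → X → ℝ} {U : Set X} (h : IsCocycleOn α U)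
    {x : X} (hx : x ∈ U) : α x x = 0 := by
  have := h.2 x hx x hx x hx
  linarith

theorem IsCocycleCover.exists_mem [TopologicalSpace X] {α : X → X → ℝ} {𝒰 : Set (Set X)}
    (h𝒰 : IsCocycleCover α 𝒰) (x : X) : ∃ U ∈ 𝒰, x ∈ U := by
  have : x ∈ ⋃₀ 𝒰 := by rw [h𝒰.covers]; trivial
  exact this

theorem IsCocycleCover.exists_subordinate [TopologicalSpace X] {α : X → X → ℝ} {𝒰 : Set (Set X)}
    (h𝒰 : IsCocycleCover α 𝒰) {γ : ℝ → X} (hγ : Continuous γ) {a b : ℝ} (hab : a ≤ b) :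
    ∃ t : ℕ → ℝ, Monotone t ∧ t 0 = a ∧ ∃ n, t n = b ∧
      ∀ k < n, ∃ U ∈ 𝒰, ∀ s ∈ Icc (t k) (t (k + 1)), γ s ∈ U := by
  obtain ⟨t, h0, hmono, ⟨m, hm⟩, ht⟩ := exists_monotone_Icc_subset_open_cover_Icc hab
    (c := fun U : 𝒰 => (fun s : Icc a b => γ s) ⁻¹' U)
    (fun U => (h𝒰.isOpen U U.2).preimage (hγ.comp continuous_subtype_val)) fun s _ => by
      obtain ⟨U, hU, hs⟩ := h𝒰.exists_mem (γ s)
      exact mem_iUnion.2 ⟨⟨U, hU⟩, hs⟩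
  refine ⟨fun k => t k, fun i j hij => hmono hij, h0, m, hm m le_rfl, fun k _ => ?_⟩
  obtain ⟨U, hU⟩ := ht k
  refine ⟨U, U.2, fun s hs => ?_⟩
  exact hU (a := ⟨s, (t k).2.1.trans hs.1, hs.2.trans (t (k + 1)).2.2⟩) ⟨hs.1, hs.2⟩

/-- A single primitive along `[a, c]` evaluates all three integrals. -/
theorem IsCocycleCover.curveIntegral_add [TopologicalSpace X] {α : X → X → ℝ} {𝒰 : Set (Set X)}
    (h𝒰 : IsCocycleCover α 𝒰) {γ : ℝ → X} (hγ : Continuous γ) {a b c : ℝ} (hab : a ≤ b)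
    (hbc : b ≤ c) :
    curveIntegral α γ a b + curveIntegral α γ b c = curveIntegral α γ a c := by
  obtain ⟨t, ht, h0, n, hn, hsub⟩ := h𝒰.exists_subordinate hγ (hab.trans hbc)
  obtain ⟨f, hf⟩ := exists_primitive h𝒰 γ t ht n hsub
  have key : ∀ s s', a ≤ s → s ≤ s' → s' ≤ c → curveIntegral α γ s s' = f s' - f s := by
    intro s s' h1 h2 h3
    obtain ⟨u, hu, hu0, m, hm, husub⟩ := h𝒰.exists_subordinate hγ h2
    have := (curveIntegral_eq_sum h𝒰 hγ u hu m husub).2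
    rw [hu0, hm] at this
    rw [this, ← hm, ← hu0, ← Finset.sum_range_sub (fun k => f (u k))]
    refine Finset.sum_congr rfl fun k hk => ?_
    have hk := Finset.mem_range.1 hk
    obtain ⟨U, hU, hs⟩ := husub k hk
    have l1 : u 0 ≤ u k := hu (Nat.zero_le k)
    have l2 : u (k + 1) ≤ u m := hu hk
    exact hf U hU _ _ (by linarith) (hu (Nat.le_succ k)) (by linarith) hs
  rw [key a b le_rfl hab hbc, key b c hab hbc le_rfl, key a c le_rfl (hab.trans hbc) le_rfl]
  ring

theorem IsCocycleCover.curveIntegral_of_mem [TopologicalSpace X] {α : X → X → ℝ}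
    {𝒰 : Set (Set X)} (h𝒰 : IsCocycleCover α 𝒰) {γ : ℝ → X} (hγ : Continuous γ) {a b : ℝ}
    (hab : a ≤ b) {U : Set X} (hU : U ∈ 𝒰) (h : ∀ s ∈ Icc a b, γ s ∈ U) :
    curveIntegral α γ a b = α (γ a) (γ b) := by
  have := (curveIntegral_eq_sum h𝒰 hγ (fun k => if k = 0 then a else b)
    (monotone_nat_of_le_succ fun k => by split_ifs <;> simp_all) 1
    fun k hk => ⟨U, hU, by simpa [Nat.lt_one_iff.1 hk] using h⟩).2
  simpa using this

/-- `α` has a continuous primitive along every orbit. -/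
theorem IsCocycleCover.exists_orbit_primitive [TopologicalSpace X] {α : X → X → ℝ}
    {𝒰 : Set (Set X)} (h𝒰 : IsCocycleCover α 𝒰) (v : Flow ℝ X) (x : X) :
    ∃ F : ℝ → ℝ, Continuous F ∧ (∀ a b, a ≤ b → orbitIntegral v α x a b = F b - F a) ∧
      ∀ t₀, ∀ᶠ t in 𝓝 t₀, F t - F t₀ = α (v t₀ x) (v t x) := by
  have hγ : Continuous fun t : ℝ => v t x := by fun_prop
  have hadd : ∀ a b c, a ≤ b → b ≤ c →
      orbitIntegral v α x a b + orbitIntegral v α x b c = orbitIntegral v α x a c :=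
    fun a b c hab hbc => h𝒰.curveIntegral_add hγ hab hbc
  -- The integral from time `0`, with the sign put in by hand: additivity is only available for
  -- ordered endpoints.
  let F : ℝ → ℝ := fun t =>
    if 0 ≤ t then orbitIntegral v α x 0 t else -orbitIntegral v α x t 0
  have hF : ∀ a b, a ≤ b → orbitIntegral v α x a b = F b - F a := by
    intro a b hab
    simp only [F]
    split_ifs with hb ha ha
    · linarith [hadd 0 a b ha hab]
    · linarith [hadd a 0 b (not_le.1 ha).le hb]
    · linarith
    · linarith [hadd a b 0 hab (not_le.1 hb).le]
  have hloc : ∀ t₀, ∀ᶠ t in 𝓝 t₀, F t - F t₀ = α (v t₀ x) (v t x) := by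
    intro t₀
    obtain ⟨U, hU, hx⟩ := h𝒰.exists_mem (v t₀ x)
    obtain ⟨δ, hδ, hball⟩ := Metric.mem_nhds_iff.1
      (((h𝒰.isOpen U hU).preimage hγ).mem_nhds hx)
    have hconv : OrdConnected (Metric.ball t₀ δ) := by
      rw [Real.ball_eq_Ioo]; exact ordConnected_Ioo
    have h0 := Metric.mem_ball_self (x := t₀) hδ
    filter_upwards [Metric.ball_mem_nhds t₀ hδ] with t ht
    rcases le_total t₀ t with h | h
    · rw [← hF t₀ t h]
      exact h𝒰.curveIntegral_of_mem hγ h hU fun s hs => hball (hconv.out h0 ht hs)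
    · have e1 : orbitIntegral v α x t t₀ = α (v t x) (v t₀ x) :=
        h𝒰.curveIntegral_of_mem hγ h hU fun s hs => hball (hconv.out ht h0 hs)
      have e2 := (h𝒰.cocycle U hU).2 _ (hball ht) _ hx _ (hball ht)
      have e3 := (h𝒰.cocycle U hU).self (hball ht)
      have e4 := hF t t₀ h
      simp only [] at e2 e3
      linarith
  refine ⟨F, continuous_iff_continuousAt.2 fun t₀ => ?_, hF, hloc⟩
  obtain ⟨U, hU, hx⟩ := h𝒰.exists_mem (v t₀ x)
  have hUo := h𝒰.isOpen U hU
  have hα : ContinuousAt (fun q : X × X => α q.1 q.2) (v t₀ x, v t₀ x) :=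
    (h𝒰.cocycle U hU).1.continuousAt ((hUo.prod hUo).mem_nhds ⟨hx, hx⟩)
  have h1 : ContinuousAt (fun t => α (v t₀ x) (v t x)) t₀ :=
    ContinuousAt.comp (f := fun t => (v t₀ x, v t x)) hα (by fun_prop)
  have h2 : ContinuousAt (fun t => F t₀ + α (v t₀ x) (v t x)) t₀ := continuousAt_const.add h1
  refine h2.congr ?_
  filter_upwards [hloc t₀] with t ht
  linarith

theorem orbitIntegral_shift [TopologicalSpace X] (v : Flow ℝ X) (α : X → X → ℝ) (x : X)
    (s a b : ℝ) : orbitIntegral v α (v s x) a b = orbitIntegral v α x (a + s) (b + s) := by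
  simp only [orbitIntegral, curveIntegral, ← v.map_add, add_sub_add_right_eq_sub]
  congr 1
  ext n
  refine Finset.sum_congr rfl fun k _ => ?_
  congr 2 <;> ring

/-- Along a piece of orbit in a set on which `α` is locally the coboundary of `B`, the increments
of a primitive are those of `B`. -/
theorem primitive_sub_eq_of_mem [TopologicalSpace X] {α : X → X → ℝ} {v : Flow ℝ X} {x : X}
    {F : ℝ → ℝ} (hF : ∀ t₀, ∀ᶠ t in 𝓝 t₀, F t - F t₀ = α (v t₀ x) (v t x)) {N : Set X} {B : X → ℝ}
    (hB : ∀ y ∈ N, ∀ᶠ z in 𝓝 y, z ∈ N → α y z = B z - B y) {s t : ℝ} (hst : s ≤ t)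
    (h : ∀ u ∈ Icc s t, v u x ∈ N) : F t - F s = B (v t x) - B (v s x) := by
  -- Equality of increments holds locally and is transitive and symmetric, so connectedness of the
  -- interval spreads it.
  refine isPreconnected_Icc.induction₂ (s := Icc s t)
    (fun u w => F w - F u = B (v w x) - B (v u x)) (fun u hu => ?_) ?_ ?_ ⟨le_rfl, hst⟩ ⟨hst, le_rfl⟩
  · have hc : ContinuousAt (fun w => v w x) u := by fun_prop
    filter_upwards [self_mem_nhdsWithin, mem_nhdsWithin_of_mem_nhds (hF u),
      mem_nhdsWithin_of_mem_nhds (hc.eventually (hB _ (h u hu)))] with w hw1 hw2 hw3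
    rw [hw2, hw3 (h w hw1)]
  · intro a b c _ _ _ h1 h2
    linarith
  · intro a b _ _ h1
    linarith

/-! ### Excursions -/

/-- Let `F` change by at least `ρ` over each gap of the closed set `Z ⊆ ℝ`, and like `b` along `Z`,
where `b` oscillates by at most `c ≤ ρ`. Then `F - b` is nondecreasing on `Z` and gains `ρ - c` over
each gap. -/
theorem le_sub_of_gaps {Z : Set ℝ} (hZ : IsClosed Z) {F b : ℝ → ℝ} (hF : Continuous F)
    {ρ c : ℝ} (hρ : 0 < ρ) (hc : c ≤ ρ)
    (hvisit : ∀ s t, s ≤ t → Icc s t ⊆ Z → F t - F s = b t - b s)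
    (hgap : ∀ s t, s < t → s ∈ Z → t ∈ Z → Disjoint (Ioo s t) Z → ρ ≤ F t - F s)
    (hosc : ∀ s ∈ Z, ∀ t ∈ Z, b t - b s ≤ c) {s t : ℝ} (hst : s ≤ t) (hs : s ∈ Z) (ht : t ∈ Z) :
    b t - b s ≤ F t - F s ∧ (¬ Icc s t ⊆ Z → b t - b s + (ρ - c) ≤ F t - F s) := by
  -- The gap around a point off `Z` lies between the nearest points of `Z` on either side.
  have hsplit : ∀ s t, s ∈ Z → t ∈ Z → ¬ Icc s t ⊆ Z → ∃ a d, s ≤ a ∧ a < d ∧ d ≤ t ∧ a ∈ Z ∧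
      d ∈ Z ∧ Disjoint (Ioo a d) Z := by
    intro s t hs ht hn
    obtain ⟨u, hu, huZ⟩ := not_subset.1 hn
    have hne1 : (Z ∩ Icc s u).Nonempty := ⟨s, hs, le_rfl, hu.1⟩
    have hne2 : (Z ∩ Icc u t).Nonempty := ⟨t, ht, hu.2, le_rfl⟩
    obtain ⟨a, ha, hamax⟩ := (isCompact_Icc.inter_left hZ).exists_isGreatest hne1
    obtain ⟨d, hd, hdmin⟩ := (isCompact_Icc.inter_left hZ).exists_isLeast hne2
    have hau : a < u := lt_of_le_of_ne ha.2.2 fun h => huZ (h ▸ ha.1)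
    have hud : u < d := lt_of_le_of_ne hd.2.1 fun h => huZ (h ▸ hd.1)
    refine ⟨a, d, ha.2.1, hau.trans hud, hd.2.2, ha.1, hd.1, disjoint_left.2 fun w hw hwZ => ?_⟩
    rcases le_total w u with h | h
    · exact absurd (hamax ⟨hwZ, ha.2.1.trans hw.1.le, h⟩) (not_le.2 hw.1)
    · exact absurd (hdmin ⟨hwZ, h, hw.2.le.trans hd.2.2⟩) (not_le.2 hw.2)
  -- `F` changes by at least `ρ` over a gap, so by uniform continuity gaps have length at least `δ`.
  -- This permits induction on the length in units of `δ`: removing a gap shortens both remaining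
  -- pieces by at least one unit.
  obtain ⟨δ, hδ, hunif⟩ := Metric.uniformContinuousOn_iff.1
    ((isCompact_Icc (a := s) (b := t)).uniformContinuousOn_of_continuous hF.continuousOn) ρ hρ
  have hlong : ∀ a d, s ≤ a → a < d → d ≤ t → a ∈ Z → d ∈ Z → Disjoint (Ioo a d) Z →
      δ ≤ d - a := by
    intro a d h1 h2 h3 h4 h5 h6
    by_contra! hlt
    have := hunif d ⟨by linarith, h3⟩ a ⟨h1, by linarith⟩
      (by rw [Real.dist_eq, abs_of_pos (by linarith)]; exact hlt)
    rw [Real.dist_eq] at this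
    linarith [le_abs_self (F d - F a), hgap a d h2 h4 h5 h6]
  have key : ∀ n : ℕ, ∀ u w, s ≤ u → u ≤ w → w ≤ t → u ∈ Z → w ∈ Z → w - u ≤ n * δ →
      b w - b u ≤ F w - F u := by
    intro n
    induction n with
    | zero =>
      intro u w _ h2 _ _ _ h
      have : u = w := by
        rw [Nat.cast_zero, zero_mul] at h
        linarith
      simp [this]
    | succ n ih =>
      intro u w h1 h2 h3 hu hw h
      by_cases hsub : Icc u w ⊆ Z
      · exact (hvisit u w h2 hsub).ge
      · obtain ⟨a, d, h4, h5, h6, ha, hd, hdis⟩ := hsplit u w hu hw hsub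
        have hl := hlong a d (by linarith) h5 (by linarith) ha hd hdis
        push_cast at h
        have e1 := ih u a h1 h4 (by linarith) hu ha (by linarith)
        have e2 := ih d w (by linarith) h6 h3 hd hw (by linarith)
        linarith [hgap a d h5 ha hd hdis, hosc a ha d hd]
  have hmono : ∀ u w, s ≤ u → u ≤ w → w ≤ t → u ∈ Z → w ∈ Z → b w - b u ≤ F w - F u := by
    intro u w h1 h2 h3 hu hw
    obtain ⟨n, hn⟩ := exists_nat_ge ((w - u) / δ)
    exact key n u w h1 h2 h3 hu hw ((div_le_iff₀ hδ).1 hn)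
  refine ⟨hmono s t le_rfl hst le_rfl hs ht, fun hn => ?_⟩
  obtain ⟨a, d, h4, h5, h6, ha, hd, hdis⟩ := hsplit s t hs ht hn
  linarith [hgap a d h5 ha hd hdis, hosc a ha d hd, hmono s a le_rfl h4 (by linarith) hs ha,
    hmono d t (by linarith) h6 le_rfl hd ht]

/-- If, in addition, `F` has bounded increments and `Z` is unbounded in both directions, then `Z`
contains neighborhoods of both ends of the line. -/
theorem eventually_mem_of_gain {Z : Set ℝ} {F b : ℝ → ℝ} {ε c C : ℝ} (hε : 0 < ε)
    (hgain : ∀ s t, s ≤ t → s ∈ Z → t ∈ Z →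
      b t - b s ≤ F t - F s ∧ (¬ Icc s t ⊆ Z → b t - b s + ε ≤ F t - F s))
    (hosc : ∀ s ∈ Z, ∀ t ∈ Z, b t - b s ≤ c) (hC : ∀ s t, s ≤ t → F t - F s ≤ C)
    (hup : ∀ u, ∃ z ∈ Z, u ≤ z) (hdown : ∀ u, ∃ z ∈ Z, z ≤ u) :
    (∀ᶠ t in atTop, t ∈ Z) ∧ ∀ᶠ t in atBot, t ∈ Z := by
  obtain ⟨z, hz, -⟩ := hup 0
  -- After `n` excursions `F` has gained at least `n * ε - c > C`.
  obtain ⟨n, hn⟩ := exists_nat_gt ((C + c) / ε)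
  rw [div_lt_iff₀ hε] at hn
  constructor
  · by_contra hcon
    rw [eventually_atTop] at hcon
    push Not at hcon
    have key : ∀ n : ℕ, ∃ t ∈ Z, z ≤ t ∧ b t - b z + n * ε ≤ F t - F z := by
      intro n
      induction n with
      | zero => exact ⟨z, hz, le_rfl, by simp⟩
      | succ n ih =>
        obtain ⟨t, ht, hzt, h⟩ := ih
        obtain ⟨u, htu, hu⟩ := hcon t
        obtain ⟨w, hw, huw⟩ := hup u
        refine ⟨w, hw, by linarith, ?_⟩
        have := (hgain t w (by linarith) ht hw).2 fun hsub => hu (hsub ⟨htu, huw⟩)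
        push_cast
        linarith
    obtain ⟨t, ht, hzt, h⟩ := key n
    linarith [hC z t hzt, hosc t ht z hz]
  · by_contra hcon
    rw [eventually_atBot] at hcon
    push Not at hcon
    have key : ∀ n : ℕ, ∃ t ∈ Z, t ≤ z ∧ b z - b t + n * ε ≤ F z - F t := by
      intro n
      induction n with
      | zero => exact ⟨z, hz, le_rfl, by simp⟩
      | succ n ih =>
        obtain ⟨t, ht, hzt, h⟩ := ih
        obtain ⟨u, htu, hu⟩ := hcon t
        obtain ⟨w, hw, huw⟩ := hdown u
        refine ⟨w, hw, by linarith, ?_⟩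
        have := (hgain w t (by linarith) hw ht).2 fun hsub => hu (hsub ⟨huw, htu⟩)
        push_cast
        linarith
    obtain ⟨t, ht, hzt, h⟩ := key n
    linarith [hC t z hzt, hosc z hz t ht]

/-! ### Potentials and trajectories off the flow neighborhoods -/

/-- `N i` and the union of the others are disjoint closed sets covering `C`. This confines an orbit
piece in the union to one flow neighborhood. -/
theorem exists_subset_of_isPreconnected [TopologicalSpace X] {n : ℕ} {N : Fin n → Set X}
    (hN : ∀ i, IsClosed (N i)) (hdisj : ∀ i j, i ≠ j → Disjoint (N i) (N j)) {C : Set X}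
    (hC : IsPreconnected C) (hne : C.Nonempty) (hsub : C ⊆ ⋃ i, N i) : ∃ i, C ⊆ N i := by
  obtain ⟨x, hx⟩ := hne
  obtain ⟨i, hi⟩ := mem_iUnion.1 (hsub hx)
  refine ⟨i, ?_⟩
  have hcl : IsClosed (⋃ j ∈ {j | j ≠ i}, N j) :=
    (Set.toFinite _).isClosed_biUnion fun j _ => hN j
  have hempty : N i ∩ ⋃ j ∈ {j | j ≠ i}, N j = ∅ := by
    refine eq_empty_of_forall_notMem fun y hy => ?_
    obtain ⟨j, hj, hyj⟩ := mem_iUnion₂.1 hy.2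
    exact disjoint_left.1 (hdisj j i hj) hyj hy.1
  refine (isPreconnected_iff_subset_of_disjoint_closed.1 hC _ _ (hN i) hcl (fun y hy => ?_)
    (by rw [hempty, inter_empty])).resolve_right fun h => ?_
  · obtain ⟨j, hj⟩ := mem_iUnion.1 (hsub hy)
    by_cases hji : j = i
    · exact Or.inl (hji ▸ hj)
    · exact Or.inr (mem_iUnion₂.2 ⟨j, hji, hj⟩)
  · have : x ∈ N i ∩ ⋃ j ∈ {j | j ≠ i}, N j := ⟨hi, h hx⟩
    rwa [hempty] at this

/-- Local primitives of `α` with small oscillation on disjoint compact sets, normalized and put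
together. -/
theorem exists_potential [TopologicalSpace X] [T2Space X] {α : X → X → ℝ} {n : ℕ}
    {N : Fin n → Set X} (hN : ∀ i, IsCompact (N i)) (hdisj : ∀ i j, i ≠ j → Disjoint (N i) (N j))
    {c : ℝ} (hosc : ∀ i, HasOscillationLE α (N i) c) :
    ∃ B : X → ℝ,
      (∀ y ∈ ⋃ i, N i, ∀ᶠ z in 𝓝 y, z ∈ ⋃ i, N i → α y z = B z - B y) ∧
      ∀ y ∈ ⋃ i, N i, ∀ z ∈ ⋃ i, N i, B z - B y ≤ c := by
  -- Subtracting the minimum puts all values in `[0, c]`, which also bounds differences between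
  -- distinct flow neighborhoods.
  have hpot : ∀ i, ∃ β : X → ℝ, (∀ y ∈ N i, ∃ O ∈ 𝓝 y, ∀ z ∈ O, α y z = β z - β y) ∧
      ∀ y ∈ N i, 0 ≤ β y ∧ β y ≤ c := by
    intro i
    obtain ⟨W, β, -, hNW, hβ, hloc, hle⟩ := hosc i
    have hO : ∀ y ∈ N i, ∃ O ∈ 𝓝 y, ∀ z ∈ O, α y z = β z - β y := by
      intro y hy
      obtain ⟨O, -, hO, hyO, h⟩ := hloc y (hNW hy)
      exact ⟨O, hO.mem_nhds hyO, fun z hz => h y hyO z hz⟩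
    rcases (N i).eq_empty_or_nonempty with he | hne
    · exact ⟨β, hO, by simp [he]⟩
    · obtain ⟨m, hm, hmin⟩ := (hN i).exists_isMinOn hne (hβ.mono hNW)
      refine ⟨fun y => β y - β m, fun y hy => ?_, fun y hy => ?_⟩
      · obtain ⟨O, hO, h⟩ := hO y hy
        exact ⟨O, hO, fun z hz => by rw [h z hz]; ring⟩
      · exact ⟨sub_nonneg.2 (hmin hy), (le_abs_self _).trans (hle m hm y hy)⟩
  choose β hβ hβc using hpot
  classical
  let B : X → ℝ := fun y => if h : ∃ i, y ∈ N i then β h.choose y else 0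
  have hB : ∀ i, ∀ y ∈ N i, B y = β i y := by
    intro i y hy
    have h : ∃ i, y ∈ N i := ⟨i, hy⟩
    have : h.choose = i := by
      by_contra hne
      exact disjoint_left.1 (hdisj _ _ hne) h.choose_spec hy
    simp only [B, dif_pos h, this]
  refine ⟨B, fun y hy => ?_, fun y hy z hz => ?_⟩
  · obtain ⟨i, hi⟩ := mem_iUnion.1 hy
    obtain ⟨O, hO, h⟩ := hβ i y hi
    have hoff : ∀ᶠ z in 𝓝 y, ∀ j, j ≠ i → z ∉ N j := by
      rw [eventually_all]
      intro j
      by_cases hji : j = i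
      · exact Eventually.of_forall fun _ h => absurd hji h
      · filter_upwards [(hN j).isClosed.isOpen_compl.mem_nhds
          (disjoint_right.1 (hdisj j i hji) hi)] with z hz _
        exact hz
    filter_upwards [hO, hoff] with z hz hzoff hzN
    obtain ⟨j, hj⟩ := mem_iUnion.1 hzN
    have hji : j = i := by
      by_contra hne
      exact hzoff j hne hj
    subst hji
    rw [hB j y hi, hB j z hj, h z hz]
  · obtain ⟨i, hi⟩ := mem_iUnion.1 hy
    obtain ⟨j, hj⟩ := mem_iUnion.1 hz
    rw [hB i y hi, hB j z hj]
    linarith [(hβc i y hi).1, (hβc j z hj).2]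

/-- Any larger interval would contain `s` or `t`, where the orbit is in `N`. -/
theorem isTrajectoryOff_Ioo [TopologicalSpace X] {v : Flow ℝ X} {N : Set X} {x : X} {s t : ℝ}
    (hst : s < t) (hs : v s x ∈ N) (ht : v t x ∈ N) (h : ∀ u ∈ Ioo s t, v u x ∉ N) :
    IsTrajectoryOff v N x (Ioo s t) where
  nonempty := nonempty_Ioo.2 hst
  ordConnected := ordConnected_Ioo
  avoids := h
  maximal J hJ hsub hav j hj := by
    obtain ⟨m, hm⟩ := nonempty_Ioo.2 hst
    constructor
    · by_contra! hle
      exact hav s (hJ.out hj (hsub hm) ⟨hle, hm.1.le⟩) hs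
    · by_contra! hle
      exact hav t (hJ.out (hsub hm) hj ⟨hm.2.le, hle⟩) ht

theorem isTrajectoryOff_ordConnectedComponent [TopologicalSpace X] {v : Flow ℝ X} {N : Set X}
    {x : X} {u : ℝ} (hu : v u x ∉ N) :
    IsTrajectoryOff v N x (ordConnectedComponent {t | v t x ∉ N} u) where
  nonempty := ⟨u, self_mem_ordConnectedComponent.2 hu⟩
  ordConnected := inferInstance
  avoids _ ht := ordConnectedComponent_subset ht
  maximal J hJ hsub hav j hj := by
    have huJ := hsub (self_mem_ordConnectedComponent.2 hu)
    exact mem_ordConnectedComponent.2 fun w hw => hav w (hJ.uIcc_subset huJ hj hw)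

/-! ### Chains -/

/-- There is a chain from `x` to `y` along which the integral of `α` is at least `K`. -/
def ChainReaches [TopologicalSpace X] (v : Flow ℝ X) (𝒰 : Set (Set X)) (T : ℝ) (α : X → X → ℝ)
    (x y : X) (K : ℝ) : Prop :=
  ∃ c : Chain v 𝒰 T, c.pt 0 = x ∧ c.pt c.n = y ∧ K ≤ c.integral α

/-- The chain with one orbit piece and one jump. -/
def Chain.single [TopologicalSpace X] {v : Flow ℝ X} {𝒰 : Set (Set X)} {T : ℝ} (x y : X) (t : ℝ)
    (ht : T ≤ t) (h : ∃ U ∈ 𝒰, v t x ∈ U ∧ y ∈ U) : Chain v 𝒰 T where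
  n := 1
  n_pos := one_pos
  pt k := if k = 0 then x else y
  time _ := t
  le_time _ _ := ht
  jump i hi := by simpa [Nat.lt_one_iff.1 hi] using h

theorem Chain.integral_single [TopologicalSpace X] {v : Flow ℝ X} {𝒰 : Set (Set X)} {T : ℝ}
    {x y : X} {t : ℝ} (ht : T ≤ t) (h : ∃ U ∈ 𝒰, v t x ∈ U ∧ y ∈ U) (α : X → X → ℝ) :
    (Chain.single x y t ht h).integral α = orbitIntegral v α x 0 t + α (v t x) y := by
  simp [Chain.integral, Chain.single]

theorem ChainReaches.trans [TopologicalSpace X] {v : Flow ℝ X} {𝒰 : Set (Set X)} {T : ℝ}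
    {α : X → X → ℝ} {x y z : X} {K L : ℝ} (h₁ : ChainReaches v 𝒰 T α x y K)
    (h₂ : ChainReaches v 𝒰 T α y z L) : ChainReaches v 𝒰 T α x z (K + L) := by
  obtain ⟨c, hc0, hcn, hc⟩ := h₁
  obtain ⟨d, hd0, hdn, hd⟩ := h₂
  -- The junction index `c.n` is assigned to the second chain; both chains have the point `y` there.
  let pt : ℕ → X := fun k => if k < c.n then c.pt k else d.pt (k - c.n)
  let time : ℕ → ℝ := fun k => if k < c.n then c.time k else d.time (k - c.n)
  have hpt1 : ∀ k ≤ c.n, pt k = c.pt k := by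
    intro k hk
    rcases hk.lt_or_eq with h | rfl
    · simp [pt, h]
    · simp [pt, hd0, hcn]
  have hpt2 : ∀ k, pt (c.n + k) = d.pt k := fun k => by simp [pt]
  have htime1 : ∀ k < c.n, time k = c.time k := fun k hk => by simp [time, hk]
  have htime2 : ∀ k, time (c.n + k) = d.time k := fun k => by simp [time]
  have hcases : ∀ i < c.n + d.n, i < c.n ∨ ∃ k < d.n, i = c.n + k := fun i hi => by
    rcases lt_or_ge i c.n with h | h
    · exact Or.inl h
    · exact Or.inr ⟨i - c.n, by omega, by omega⟩
  refine ⟨⟨c.n + d.n, by have := c.n_pos; omega, pt, time, fun i hi => ?_, fun i hi => ?_⟩,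
    ?_, ?_, ?_⟩
  · rcases hcases i hi with h | ⟨k, hk, rfl⟩
    · rw [htime1 i h]; exact c.le_time i h
    · rw [htime2]; exact d.le_time k hk
  · rcases hcases i hi with h | ⟨k, hk, rfl⟩
    · rw [htime1 i h, hpt1 i h.le, hpt1 (i + 1) h]; exact c.jump i h
    · rw [htime2, hpt2, add_assoc, hpt2]; exact d.jump k hk
  · exact (hpt1 0 (Nat.zero_le _)).trans hc0
  · exact (hpt2 d.n).trans hdn
  · refine (add_le_add hc hd).trans_eq ?_
    simp only [Chain.integral]
    rw [Finset.sum_range_add]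
    congr 1
    · refine Finset.sum_congr rfl fun i hi => ?_
      have hi := Finset.mem_range.1 hi
      rw [htime1 i hi, hpt1 i hi.le, hpt1 (i + 1) hi]
    · refine Finset.sum_congr rfl fun k _ => ?_
      rw [htime2, hpt2, add_assoc, hpt2]

theorem ChainReaches.mono [TopologicalSpace X] {v : Flow ℝ X} {𝒰 : Set (Set X)} {T : ℝ}
    {α : X → X → ℝ} {x y : X} {K L : ℝ} (h : ChainReaches v 𝒰 T α x y K) (hLK : L ≤ K) :
    ChainReaches v 𝒰 T α x y L :=
  let ⟨c, h0, hn, hc⟩ := h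
  ⟨c, h0, hn, hLK.trans hc⟩

/-- If the chain integrals are bounded, there is no closed chain with positive integral. -/
theorem not_chainReaches_self [TopologicalSpace X] {v : Flow ℝ X} {𝒰 : Set (Set X)} {T : ℝ}
    {α : X → X → ℝ} {M : ℝ} (hM : ∀ c : Chain v 𝒰 T, |c.integral α| ≤ M) {ε : ℝ} (hε : 0 < ε)
    (x : X) : ¬ ChainReaches v 𝒰 T α x x ε := by
  intro h
  -- The factor is `n + 1` because a chain has at least one orbit piece, so there is no empty
  -- repetition.
  have hn : ∀ n : ℕ, ChainReaches v 𝒰 T α x x ((n + 1) * ε) := by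
    intro n
    induction n with
    | zero => simpa using h
    | succ n ih =>
      refine (ih.trans h).mono (le_of_eq ?_)
      push_cast
      ring
  obtain ⟨n, hnM⟩ := exists_nat_gt (M / ε)
  rw [div_lt_iff₀ hε] at hnM
  obtain ⟨c, -, -, hc⟩ := hn n
  linarith [hM c, le_abs_self (c.integral α)]

theorem chainReaches_single [TopologicalSpace X] {v : Flow ℝ X} {𝒰 : Set (Set X)}
    {T : ℝ} {α : X → X → ℝ} {x y : X} {t : ℝ} (ht : T ≤ t) (h : ∃ U ∈ 𝒰, v t x ∈ U ∧ y ∈ U) :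
    ChainReaches v 𝒰 T α x y (orbitIntegral v α x 0 t + α (v t x) y) :=
  ⟨Chain.single x y t ht h, rfl, rfl, (Chain.integral_single ht h α).ge⟩

/-- Bounded chain integrals bound the increments of primitives along orbits. -/
theorem primitive_sub_le_of_chain_bound [TopologicalSpace X] {v : Flow ℝ X} {𝒰 : Set (Set X)}
    {T : ℝ} {α : X → X → ℝ} (h𝒰 : IsCocycleCover α 𝒰) (hT : 0 < T) {M : ℝ}
    (hM : ∀ c : Chain v 𝒰 T, |c.integral α| ≤ M) {x : X} {F : ℝ → ℝ}
    (hF : ∀ a b, a ≤ b → orbitIntegral v α x a b = F b - F a) {s t : ℝ} (hst : s ≤ t) :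
    F t - F s ≤ 2 * M := by
  -- A piece of duration at least `T` with a trivial jump is a chain. A shorter piece is the
  -- difference of two such pieces starting at `s - T`, whence `2 * M`.
  have key : ∀ a b, T ≤ b - a → |F b - F a| ≤ M := by
    intro a b hab
    obtain ⟨U, hU, hx⟩ := h𝒰.exists_mem (v (b - a) (v a x))
    have h := hM (Chain.single (v a x) (v (b - a) (v a x)) (b - a) hab ⟨U, hU, hx, hx⟩)
    rwa [Chain.integral_single, (h𝒰.cocycle U hU).self hx, orbitIntegral_shift, add_zero, zero_add,
      sub_add_cancel, hF a b (by linarith)] at h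
  have h1 := abs_le.1 (key (s - T) t (by linarith))
  have h2 := abs_le.1 (key (s - T) s (by linarith))
  linarith [h1.2, h2.1]

/-- Along every orbit of a flow with bounded chain integrals, a primitive of `α` minus the potential
`B` on `N` is nondecreasing while in `N`, with a definite gain over each excursion, and the
orbit ends up in `N` in both time directions. -/
theorem exists_primitive_gain [TopologicalSpace X] {v : Flow ℝ X} {𝒰 : Set (Set X)} {T : ℝ}
    {α : X → X → ℝ} (h𝒰 : IsCocycleCover α 𝒰) (hT : 0 < T) {M : ℝ}
    (hM : ∀ c : Chain v 𝒰 T, |c.integral α| ≤ M) {N : Set X} (hN : IsClosed N) {B : X → ℝ}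
    (hB : ∀ y ∈ N, ∀ᶠ z in 𝓝 y, z ∈ N → α y z = B z - B y) {c ρ T₀ : ℝ}
    (hosc : ∀ y ∈ N, ∀ z ∈ N, B z - B y ≤ c) (hρ : 0 < ρ) (hc : c < ρ) (hT₀ : 0 < T₀)
    (hbdd : ∀ x a b, a < b → IsTrajectoryOff v N x (Ioo a b) → ρ ≤ orbitIntegral v α x a b)
    (hunbdd : ∀ x I, IsTrajectoryOff v N x I → (¬ BddAbove I ∨ ¬ BddBelow I) →
      ∀ s, Icc s (s + T₀) ⊆ I → ρ ≤ orbitIntegral v α x s (s + T₀)) (x : X) :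
    ∃ F : ℝ → ℝ, (∀ a b, a ≤ b → orbitIntegral v α x a b = F b - F a) ∧
      (∀ s t, s ≤ t → v s x ∈ N → v t x ∈ N →
        B (v t x) - B (v s x) ≤ F t - F s ∧ ((∃ u ∈ Icc s t, v u x ∉ N) →
          B (v t x) - B (v s x) + (ρ - c) ≤ F t - F s)) ∧
      (∀ᶠ t in atTop, v t x ∈ N) ∧ ∀ᶠ t in atBot, v t x ∈ N := by
  obtain ⟨F, hFc, hF, hFloc⟩ := h𝒰.exists_orbit_primitive v x
  have hFM : ∀ s t, s ≤ t → F t - F s ≤ 2 * M := fun s t =>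
    primitive_sub_le_of_chain_bound h𝒰 hT hM hF
  set Z : Set ℝ := {t | v t x ∈ N}
  have hZ : IsClosed Z := hN.preimage (f := fun t => v t x) (by fun_prop)
  have hgain : ∀ s t, s ≤ t → s ∈ Z → t ∈ Z → B (v t x) - B (v s x) ≤ F t - F s ∧
      (¬ Icc s t ⊆ Z → B (v t x) - B (v s x) + (ρ - c) ≤ F t - F s) := by
    intro s t hst hs ht
    refine le_sub_of_gaps (b := fun t => B (v t x)) hZ hFc hρ hc.le
      (fun a d had h => primitive_sub_eq_of_mem hFloc hB had h) ?_
      (fun a ha d hd => hosc _ ha _ hd) hst hs ht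
    intro a d had ha hd hdis
    rw [← hF a d had.le]
    exact hbdd x a d had (isTrajectoryOff_Ioo had ha hd fun u hu => disjoint_left.1 hdis hu)
  obtain ⟨n, hn⟩ := exists_nat_gt (2 * M / ρ)
  rw [div_lt_iff₀ hρ] at hn
  have hlarge : ∀ a, ¬ ∀ k : ℕ, ρ ≤ F (a + (k + 1) * T₀) - F (a + k * T₀) := by
    intro a h
    have hk : ∀ k : ℕ, k * ρ ≤ F (a + k * T₀) - F a := by
      intro k
      induction k with
      | zero => simp
      | succ k ih =>
        have := h k
        push_cast
        linarith
    have h0 : (0 : ℝ) ≤ n * T₀ := by positivity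
    linarith [hk n, hFM a (a + n * T₀) (by linarith)]
  have hpiece : ∀ u a, u ∉ Z → (¬ BddAbove (ordConnectedComponent {t | v t x ∉ N} u) ∨
      ¬ BddBelow (ordConnectedComponent {t | v t x ∉ N} u)) →
      Icc a (a + T₀) ⊆ ordConnectedComponent {t | v t x ∉ N} u → ρ ≤ F (a + T₀) - F a := by
    intro u a hu hub hsub
    rw [← hF _ _ (by linarith)]
    exact hunbdd x _ (isTrajectoryOff_ordConnectedComponent hu) hub a hsub
  -- If `N` is never met after `u`, the interval of existence contains a half-line, and consecutive
  -- pieces of duration `T₀` gain `ρ` each, beyond the bound `2 * M`.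
  have hup : ∀ u, ∃ z ∈ Z, u ≤ z := by
    intro u
    by_contra! h
    have hsub : Ici u ⊆ ordConnectedComponent {t | v t x ∉ N} u := fun w hw =>
      mem_ordConnectedComponent.2 fun y hy hyZ => by
        rw [uIcc_of_le hw] at hy
        exact absurd hy.1 (not_le.2 (h y hyZ))
    refine hlarge u fun k => ?_
    have := hpiece u (u + k * T₀) (fun hu => lt_irrefl u (h u hu))
      (Or.inl fun hb => not_bddAbove_Ici u (hb.mono hsub)) fun w hw => hsub ?_
    · rwa [show u + (k + 1) * T₀ = u + k * T₀ + T₀ by ring]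
    · have : (0 : ℝ) ≤ k * T₀ := by positivity
      exact le_trans (by linarith) hw.1
  have hdown : ∀ u, ∃ z ∈ Z, z ≤ u := by
    intro u
    by_contra! h
    have hsub : Iic u ⊆ ordConnectedComponent {t | v t x ∉ N} u := fun w hw =>
      mem_ordConnectedComponent.2 fun y hy hyZ => by
        rw [uIcc_of_ge hw] at hy
        exact absurd hy.2 (not_le.2 (h y hyZ))
    have hk : ∀ k : ℕ, k * ρ ≤ F u - F (u - k * T₀) := by
      intro k
      induction k with
      | zero => simp
      | succ k ih =>
        have h0 : (0 : ℝ) ≤ k * T₀ := by positivity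
        have := hpiece u (u - (k + 1) * T₀) (fun hu => lt_irrefl u (h u hu))
          (Or.inr fun hb => not_bddBelow_Iic u (hb.mono hsub)) fun w hw => hsub
            (hw.2.trans (by linarith))
        rw [show u - (k + 1) * T₀ + T₀ = u - k * T₀ by ring] at this
        push_cast
        linarith
    have h0 : (0 : ℝ) ≤ n * T₀ := by positivity
    linarith [hk n, hFM (u - n * T₀) u (by linarith)]
  refine ⟨F, hF, fun s t hst hs ht => ⟨(hgain s t hst hs ht).1, fun ⟨u, hu, huN⟩ =>
    (hgain s t hst hs ht).2 fun h => huN (h hu)⟩, ?_⟩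
  exact eventually_mem_of_gain (b := fun t => B (v t x)) (sub_pos.2 hc) hgain
    (fun a ha d hd => hosc _ ha _ hd) hFM hup hdown

/-- A connecting orbit yields a chain between its limit points along which `α` gains. -/
theorem chainReaches_of_connects [TopologicalSpace X] {v : Flow ℝ X} {𝒰 : Set (Set X)} {T : ℝ}
    {α : X → X → ℝ} (h𝒰 : IsCocycleCover α 𝒰) {N : Set X} {B : X → ℝ}
    (hB : ∀ y ∈ N, ∀ᶠ z in 𝓝 y, z ∈ N → α y z = B z - B y) {ε : ℝ} {x : X} {F : ℝ → ℝ}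
    (hF : ∀ a b, a ≤ b → orbitIntegral v α x a b = F b - F a)
    (hgain : ∀ s t, s ≤ t → v s x ∈ N → v t x ∈ N → (∃ u ∈ Icc s t, v u x ∉ N) →
      B (v t x) - B (v s x) + ε ≤ F t - F s) (hleave : ∃ u, v u x ∉ N) {p q : X}
    (hp : p ∈ fixedPoints v) (hpN : N ∈ 𝓝 p) (hqN : N ∈ 𝓝 q)
    (hxp : Tendsto (fun t => v t x) atBot (𝓝 p)) (hxq : Tendsto (fun t => v t x) atTop (𝓝 q)) :
    ChainReaches v 𝒰 T α p q (B q - B p + ε) := by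
  obtain ⟨U, hU, hpU⟩ := h𝒰.exists_mem p
  obtain ⟨W, hW, hqW⟩ := h𝒰.exists_mem q
  obtain ⟨u, hu⟩ := hleave
  have hnear : ∀ {y : X} {O : Set X}, O ∈ 𝒰 → y ∈ O → N ∈ 𝓝 y →
      ∀ᶠ z in 𝓝 y, z ∈ O ∧ z ∈ N ∧ (z ∈ N → α y z = B z - B y) := fun hO hy hN =>
    (eventually_mem_set.2 ((h𝒰.isOpen _ hO).mem_nhds hy)).and
      ((eventually_mem_set.2 hN).and (hB _ (mem_of_mem_nhds hN)))
  have h1 := (hxp.comp tendsto_neg_atTop_atBot).eventually (hnear hU hpU hpN)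
  have h2 := hxq.eventually (hnear hW hqW hqN)
  -- The chain rests at `p` for time `T`, jumps to the orbit at time `-s`, follows it to time `s`
  -- and jumps to `q`. The condition `s ≥ |u|` keeps the excursion inside the piece; the jumps
  -- contribute differences of `B`, which telescope.
  obtain ⟨s, ⟨hsU, hsN, hsα⟩, ⟨hsW, hsN', hsα'⟩, hsT, hs0, hsu⟩ :=
    (h1.and (h2.and ((eventually_ge_atTop T).and ((eventually_ge_atTop 0).and
      (eventually_ge_atTop |u|))))).exists
  simp only [Function.comp_apply] at hsU hsN hsα
  have c1 := chainReaches_single (v := v) (α := α) (x := p) (y := v (-s) x) (le_refl T)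
    ⟨U, hU, by rwa [hp T], hsU⟩
  have hend : v (s + s) (v (-s) x) = v s x := by rw [← v.map_add]; simp
  have c2 := chainReaches_single (v := v) (α := α) (x := v (-s) x) (y := q)
    (show T ≤ s + s by linarith) ⟨W, hW, by rwa [hend], hqW⟩
  refine (c1.trans c2).mono ?_
  have e1 : orbitIntegral v α p 0 T = 0 := by
    have hpp : α p p = 0 := (h𝒰.cocycle U hU).self hpU
    have : ∀ n : ℕ, ∑ k ∈ Finset.range n, α (v (0 + k * ((T - 0) / n)) p)
        (v (0 + (k + 1 : ℕ) * ((T - 0) / n)) p) = 0 := fun n =>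
      Finset.sum_eq_zero fun k _ => by rw [hp, hp, hpp]
    simp only [orbitIntegral, curveIntegral, this]
    exact tendsto_const_nhds.limUnder_eq
  have e2 : α (v s x) q + α q (v s x) = 0 := by
    rw [(h𝒰.cocycle W hW).2 _ hsW _ hqW _ hsW]
    exact (h𝒰.cocycle W hW).self hsW
  have e3 := hgain (-s) s (by linarith) hsN hsN' ⟨u, abs_le.1 hsu, hu⟩
  rw [e1, hp T, hend, orbitIntegral_shift, hF _ _ (by linarith), zero_add, zero_add, add_neg_cancel_right]
  linarith [hsα hsN, hsα' hsN']

end CocycleFlow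

/-! ### Convergence and acyclicity for the given `α`-flow. -/

open CocycleFlow Set Filter Topology in
theorem corollary3p5 {X : Type*} [MetricSpace X] [CompactSpace X] (v : Flow ℝ X)
    (α : X → X → ℝ) (hv : CocycleFlow.IsAlphaFlow v α)
    (𝒰 : Set (Set X)) (h𝒰 : CocycleFlow.IsCocycleCover α 𝒰) (T : ℝ) (hT : 0 < T)
    (hbound : ∃ M : ℝ, 0 < M ∧ ∀ c : CocycleFlow.Chain v 𝒰 T, |c.integral α| ≤ M) :
    CocycleFlow.IsGradientLike v := by
  obtain ⟨M, -, hM⟩ := hbound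
  obtain ⟨n, p, hv⟩ := hv
  obtain ⟨U, V, N, r, T₀, ρ, lam, hr, hT₀, hρ, -, hlam, hU, hV, hN, hdisj, hosc, hbdd, hunbdd⟩ :=
    hv.carries
  have hNV : ∀ i, N i ⊆ V i := by
    intro i x hx
    rcases (hN i).subset_nhds hx with ⟨t, ht, h, -⟩ | ⟨t, ht, h, -⟩
    · simpa using h 0 ⟨le_rfl, ht⟩
    · simpa using h 0 ⟨ht, le_rfl⟩
  have hNcl : ∀ i, IsClosed (N i) := fun i => (hN i).isCompact.isClosed
  -- `N i ⊆ V i ⊆ U i`, and `U i` isolates `p i`.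
  have hNinv : ∀ i x, (∀ t, v t x ∈ N i) → x = p i := by
    intro i x hx
    have : x ∈ ({p i} : Set X) := by
      rw [(hU i).eq_maximal]
      exact fun t => (hV i).2.2 (hNV i (hx t))
    exact this
  have hpfix : ∀ i, p i ∈ fixedPoints v := by
    intro i t
    have h : ∀ s, v s (p i) ∈ U i := by
      have : p i ∈ ({p i} : Set X) := rfl
      rw [(hU i).eq_maximal] at this
      exact this
    have : v t (p i) ∈ ({p i} : Set X) := by
      rw [(hU i).eq_maximal]
      intro s
      rw [← v.map_add]
      exact h _
    exact this
  have hNnhds : ∀ i, N i ∈ 𝓝 (p i) := by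
    intro i
    refine mem_of_superset (inter_mem ?_ ?_) (hN i).ball_subset
    · exact mem_of_superset (Metric.ball_mem_nhds (p i) hr)
        (Metric.ball_subset_closedBall.trans (Metric.cthickening_singleton (p i) hr.le).ge)
    · exact mem_interior_iff_mem_nhds.1 ((hV i).2.1 rfl)
  obtain ⟨B, hB, hBosc⟩ := exists_potential (fun i => (hN i).isCompact) hdisj hosc
  have hunion : IsClosed (⋃ i, N i) := isClosed_iUnion_of_finite hNcl
  have hgap : lam * ρ < ρ := mul_lt_of_lt_one_left hρ hlam
  have horbit := exists_primitive_gain h𝒰 hT hM hunion hB hBosc hρ hgap hT₀ hbdd hunbdd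
  -- Stated for an arbitrary flow so that it also applies to `v.reverse`, which gives the backward
  -- limits.
  have hlim : ∀ (w : Flow ℝ X), (∀ i x, (∀ t, w t x ∈ N i) → x = p i) →
      ∀ x, (∀ᶠ t in atTop, w t x ∈ ⋃ i, N i) →
        ∃ q ∈ range p, Tendsto (fun t => w t x) atTop (𝓝 q) := by
    intro w hw x hx
    obtain ⟨a, ha⟩ := eventually_atTop.1 hx
    have hc : Continuous fun t : ℝ => w t x := by fun_prop
    obtain ⟨i, hi⟩ := exists_subset_of_isPreconnected hNcl hdisj
      (isPreconnected_Ici.image _ hc.continuousOn) (nonempty_Ici.image (fun t => w t x))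
      (image_subset_iff.2 fun t ht => ha t ht)
    exact ⟨p i, ⟨i, rfl⟩, tendsto_of_eventually_mem w (hN i).isCompact (hNcl i) (hw i)
      (eventually_atTop.2 ⟨a, fun t ht => hi ⟨t, ht, rfl⟩⟩)⟩
  have htop : ∀ x, ∃ q ∈ range p, Tendsto (fun t => v t x) atTop (𝓝 q) := fun x =>
    let ⟨_, _, _, h, _⟩ := horbit x
    hlim v hNinv x h
  have hbot : ∀ x, ∃ q ∈ range p, Tendsto (fun t => v t x) atBot (𝓝 q) := by
    intro x
    obtain ⟨_, _, _, _, h⟩ := horbit x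
    obtain ⟨q, hq, hxq⟩ := hlim v.reverse
      (fun i y hy => hNinv i y fun t => by simpa [Flow.reverse_apply] using hy (-t)) x
      (tendsto_neg_atTop_atBot.eventually h)
    exact ⟨q, hq, tendsto_reverse_atTop.1 hxq⟩
  have hedge : ∀ q q', Connects v q q' →
      ChainReaches v 𝒰 T α q q' (B q' - B q + (ρ - lam * ρ)) := by
    rintro q q' ⟨x, hx, hxq, hxq'⟩
    obtain ⟨F, hF, hgain, -, -⟩ := horbit x
    obtain ⟨_, ⟨i, rfl⟩, hi⟩ := hbot x
    obtain ⟨_, ⟨j, rfl⟩, hj⟩ := htop x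
    obtain rfl := tendsto_nhds_unique hi hxq
    obtain rfl := tendsto_nhds_unique hj hxq'
    refine chainReaches_of_connects h𝒰 hB hF (fun s t hst hs ht => (hgain s t hst hs ht).2) ?_
      (hpfix i) (mem_of_superset (hNnhds i) (subset_iUnion N i))
      (mem_of_superset (hNnhds j) (subset_iUnion N j)) hxq hxq'
    -- An orbit that never leaves the union lies in a single `N k`, so it is the rest point `p k`.
    by_contra! hstay
    have hc : Continuous fun t : ℝ => v t x := by fun_prop
    obtain ⟨k, hk⟩ := exists_subset_of_isPreconnected hNcl hdisj
      (isPreconnected_range hc) (range_nonempty _) (range_subset_iff.2 hstay)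
    exact hx (hNinv k x (fun t => hk ⟨t, rfl⟩) ▸ hpfix k)
  have hgain : 0 < ρ - lam * ρ := sub_pos.2 hgap
  have hpath : ∀ q q', Relation.TransGen (Connects v) q q' →
      ChainReaches v 𝒰 T α q q' (B q' - B q + (ρ - lam * ρ)) := by
    intro q q' h
    induction h with
    | single h => exact hedge _ _ h
    -- The potential differences telescope; only one of the two gains is kept.
    | tail _ h ih => exact (ih.trans (hedge _ _ h)).mono (by linarith)
  refine isGradientLike_of_acyclic v (finite_range p) (range_subset_iff.2 hpfix) ?_ htop hbot
    fun q hq => not_chainReaches_self hM hgain q ((hpath q q hq).mono (by linarith))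
  rintro _ ⟨i, rfl⟩
  exact ⟨N i, hNcl i, hNnhds i, hNinv i⟩
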